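/- Let $\Sigma$ be a monoid and let $V$ be a finite-dimensional real representation of $\Sigma$, that is, a finite-dimensional real vector space with a monoid homomorphism $\sigma \mapsto A_\sigma$ from $\Sigma$ to the linear maps $V \to V$. A homomorphism of representations is a linear map commuting with the actions of $\Sigma$; $\operatorname{End}_\Sigma(V)$ is the (finite-dimensional real) vector space of endomorphisms of $V$. A representation is indecomposable if it is nonzero and is not the direct sum of two proper subrepresentations. For an indecomposable finite-dimensional real representation $X$ the nilpotent endomorphisms form an ideal $\operatorname{Nil}_\Sigma(X)$ of $\operatorname{End}_\Sigma(X)$, the quotient $\operatorname{End}_\Sigma(X)/\operatorname{Nil}_\Sigma(X)$ is a real division algebra, and $\operatorname{ind} X \in \{1,2,4\}$ denotes its real dimension. The generalized kernel of $L \in \operatorname{End}_\Sigma(V)$ is the subrepresentation $\ker L^{\dim V}$. Suppose that $$V \cong X_1^{j_1} \oplus \dots \oplus X_m^{j_m},$$ where $X_1,\dots,X_m$ are pairwise nonisomorphic indecomposable finite-dimensional real representations of $\Sigma$. Let $0 \le k \le m$, let $1 \le i_1 < \dots < i_k \le m$ and $1 \le s_r \le j_{i_r}$, and put $W_r = X_{i_r}^{s_r}$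 for $r = 1,\dots,k$. Then the set $$\{ L \in \operatorname{End}_\Sigma(V) : \text{the generalized kernel of } L \text{ is isomorphic to } W_1 \oplus \dots \oplus W_k \text{ as a representation} \}$$ is contained in a finite union of smooth embedded submanifolds of $\operatorname{End}_\Sigma(V)$, each of which has codimension $\sum_{r=1}^k d_r$ for some integers $d_1,\dots,d_k$ (depending on the submanifold) with $$d_r \in \begin{cases} \{s_r\} \cup \{p^2 : 2 \le p \le s_r\} & \text{if } \operatorname{ind} X_{i_r} = 1,\\ \{p^2 \cdot \operatorname{ind} X_{i_r} : 1 \le p \le s_r\} & \text{if } \operatorname{ind} X_{i_r} \in \{2,4\}. \end{cases}$$ -/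

import Mathlib

open scoped ContDiff

noncomputable section

namespace MonoidRep

section Representations

variable {S V : Type*} [Monoid S] [AddCommGroup V] [Module ℝ V]

/-- The space `End_S(V)` of endomorphisms of a real representation of the monoid `S`. -/
abbrev End (ρ : Representation ℝ S V) := Representation.IntertwiningMap ρ ρ

/-- A representation is indecomposable if it is nonzero and is not the direct sum of two proper
subrepresentations. -/
def IsIndecomposable (ρ : Representation ℝ S V) : Prop :=
  Nontrivial V ∧ ∀ W W' : Subrepresentation ρ,
    IsCompl W.toSubmodule W'.toSubmodule → W = ⊤ ∨ W' = ⊤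

/-- The direct sum `X ⊕ ⋯ ⊕ X` of `s` copies of a representation `X`. -/
def power (ρ : Representation ℝ S V) (s : ℕ) :
    Representation ℝ S (DirectSum (Fin s) fun _ => V) :=
  Representation.directSum fun _ : Fin s => ρ

/-- The linear subspace of `End_S(V)` spanned by the nilpotent endomorphisms. For an indecomposable
representation the nilpotent endomorphisms already form a linear subspace, so that this is the set
of nilpotent endomorphisms: see `mem_nilSpace_iff` below. -/
def nilSpace (ρ : Representation ℝ S V) : Submodule ℝ (End ρ) :=
  Submodule.span ℝ {L : End ρ | IsNilpotent L}

theorem toLinearMap_pow {ρ : Representation ℝ S V} (L : End ρ) (n : ℕ) :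
    (L ^ n).toLinearMap = L.toLinearMap ^ n := by
  induction n with
  | zero => rfl
  | succ n ih =>
    rw [pow_succ, pow_succ, ← ih]
    rfl

/-- Fitting: an endomorphism of an indecomposable representation is nilpotent or bijective. -/
theorem isNilpotent_or_bijective {ρ : Representation ℝ S V} [FiniteDimensional ℝ V]
    (h : IsIndecomposable ρ) (L : End ρ) :
    IsNilpotent L ∨ Function.Bijective L.toLinearMap := by
  obtain ⟨n, hn⟩ := Filter.eventually_atTop.1 L.toLinearMap.eventually_isCompl_ker_pow_range_pow
  have hc := hn (n + 1) (Nat.le_succ n)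
  have hpow : (L ^ (n + 1)).toLinearMap = L.toLinearMap ^ (n + 1) :=
    toLinearMap_pow L (n + 1)
  rw [← hpow] at hc
  rcases h.2 (L ^ (n + 1)).ker (L ^ (n + 1)).range hc with h1 | h1
  · left
    refine ⟨n + 1, ?_⟩
    have h2 : (L ^ (n + 1)).toLinearMap.ker = ⊤ := congrArg Subrepresentation.toSubmodule h1
    exact Representation.IntertwiningMap.ext (LinearMap.ker_eq_top.1 h2)
  · right
    have h2 : (L ^ (n + 1)).toLinearMap.range = ⊤ := congrArg Subrepresentation.toSubmodule h1
    rw [hpow, pow_succ'] at h2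
    have h3 : Function.Surjective L.toLinearMap := by
      have := LinearMap.range_eq_top.1 h2
      rw [Module.End.mul_eq_comp, LinearMap.coe_comp] at this
      exact this.of_comp
    exact ⟨LinearMap.injective_iff_surjective.2 h3, h3⟩

/-- For an indecomposable representation `nilSpace` consists of the nilpotent endomorphisms. -/
theorem mem_nilSpace_iff {ρ : Representation ℝ S V} [FiniteDimensional ℝ V]
    (h : IsIndecomposable ρ) (L : End ρ) : L ∈ nilSpace ρ ↔ IsNilpotent L := by
  have := h.1
  have fix : ∀ (c : End ρ) (v : V), IsNilpotent c → c v = v → v = 0 := by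
    rintro c v ⟨n, hn⟩ hv
    have hp : ∀ n : ℕ, (c ^ n) v = v := by
      intro n
      induction n with
      | zero => rfl
      | succ n ih =>
        rw [pow_succ]
        change (c ^ n) (c v) = v
        rw [hv, ih]
    rw [← hp n, hn]
    rfl
  have ninj : ∀ c : End ρ, IsNilpotent c → ¬ Function.Injective c.toLinearMap := by
    rintro c ⟨n, hn⟩ hc
    obtain ⟨v, hv⟩ := exists_ne (0 : V)
    apply hv
    have hp : ∀ n : ℕ, Function.Injective (c.toLinearMap ^ n) := by
      intro n
      rw [Module.End.coe_pow]
      exact hc.iterate n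
    apply hp n
    rw [← toLinearMap_pow, hn]
    rfl
  constructor
  · intro hL
    induction hL using Submodule.span_induction with
    | mem x hx => exact hx
    | zero => exact IsNilpotent.zero
    | smul a x _ hx =>
      obtain ⟨n, hn⟩ := hx
      exact ⟨n, by rw [smul_pow, hn, smul_zero]⟩
    | add a b _ _ ha hb =>
      rcases isNilpotent_or_bijective h (a + b) with h1 | h1
      · exact h1
      exfalso
      let u : End ρ := (Representation.IntertwiningMap.ofBijective (a + b) h1).symm.toIntertwiningMap
      have hu : ∀ v, u (a v) + u (b v) = v := by
        intro v
        rw [← map_add]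
        exact (Representation.IntertwiningMap.ofBijective (a + b) h1).symm_apply_apply v
      have hua : IsNilpotent (u * a) := by
        refine (isNilpotent_or_bijective h (u * a)).resolve_right fun hb' => ninj a ha ?_
        exact Function.Injective.of_comp (f := u) hb'.1
      refine ninj b hb ((injective_iff_map_eq_zero _).2 fun v hv => fix (u * a) v hua ?_)
      have h2 := hu v
      have hv' : b v = 0 := hv
      rw [hv', map_zero, add_zero] at h2
      exact h2
  · exact fun hL => Submodule.subset_span hL

/-- The index of an indecomposable representation: the real dimension of the quotient of its
endomorphisms by its nilpotent endomorphisms. -/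
def ind (ρ : Representation ℝ S V) : ℕ :=
  Module.finrank ℝ (End ρ ⧸ nilSpace ρ)

/-- The generalized kernel of `L`: the kernel of `L ^ n` with `n = dim V`. -/
def gker (ρ : Representation ℝ S V) (L : End ρ) : Subrepresentation ρ :=
  (L ^ Module.finrank ℝ V).ker

/-- The set of endomorphisms of `V` whose generalized kernel is isomorphic, as a representation,
to `W`. -/
def isoSet (ρ : Representation ℝ S V) {W : Type*} [AddCommGroup W] [Module ℝ W]
    (ρW : Representation ℝ S W) : Set (End ρ) :=
  {L | Nonempty ((gker ρ L).toRepresentation.Equiv ρW)}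

end Representations

section Submanifolds

/-- `M ⊆ ℝⁿ` is a smooth embedded submanifold of codimension `c`: near each of its points it is the
zero set of a smooth submersion to `ℝᶜ`. -/
def IsSubmanifoldOfCoordSpace {n : ℕ} (c : ℕ) (M : Set (Fin n → ℝ)) : Prop :=
  ∀ x ∈ M, ∃ (U : Set (Fin n → ℝ)) (f : (Fin n → ℝ) → (Fin c → ℝ)),
    IsOpen U ∧ x ∈ U ∧ ContDiffOn ℝ ∞ f U ∧
    (∀ y ∈ U, Function.Surjective (fderiv ℝ f y)) ∧ M ∩ U = {y | y ∈ U ∧ f y = 0}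

/-- A subset of a finite-dimensional real vector space `E` is a smooth embedded submanifold of
codimension `c` if it is one in linear coordinates on `E`. (Changes of linear coordinates are
diffeomorphisms, so that one coordinate system is as good as any other.) -/
def IsSubmanifold {E : Type*} [AddCommGroup E] [Module ℝ E] [FiniteDimensional ℝ E]
    (c : ℕ) (M : Set E) : Prop :=
  ∀ e : E ≃ₗ[ℝ] (Fin (Module.finrank ℝ E) → ℝ), IsSubmanifoldOfCoordSpace c (e '' M)

end Submanifolds

/-- The possible values of the contribution `d` to the codimension of an isotypic component `X ^ s`
of the generalized kernel, when `X` has index `i`: `s` or `p²` with `2 ≤ p ≤ s` if `i = 1`, and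
`p² i` with `1 ≤ p ≤ s` if `i` is `2` or `4`. -/
def codims (i s : ℕ) : Set ℕ :=
  {d | (i = 1 ∧ (d = s ∨ ∃ p, 2 ≤ p ∧ p ≤ s ∧ d = p ^ 2)) ∨
    ((i = 2 ∨ i = 4) ∧ ∃ p, 1 ≤ p ∧ p ≤ s ∧ d = p ^ 2 * i)}

end MonoidRep

end

/-!
Write `V` as the direct sum of the powers `X_i ^ j_i`, and let `D_i` be the residue division algebra
of `X_i`, that is, its endomorphisms modulo the nilpotent ones (`exists_residueAlgebra`). By Frobenius
its real dimension `ind X_i` is `1`, `2` or `4` (`finrank_divisionRing`). The entries of an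
endomorphism `L` of `V` between the copies of `X_i`, reduced to `D_i`, form a matrix `π_i L`. As a map
`X_i → X_l → X_i` is nilpotent for `l ≠ i` (`isNilpotent_comp`), this matrix is multiplicative in `L`
(`blockMatrix_comp`), and the maps `π_i` are jointly surjective.

If the generalized kernel of `L` is isomorphic to the sum of the `X_{i_r} ^ s_r`, then the Fitting
decomposition of `L` (`exists_fitting`) is carried by `π_{i_r}` to one of the matrix: it is
nilpotent on a summand of rank `s_r` and invertible on a complement (`HasFittingBlock`). So its
corank `p` satisfies `1 ≤ p ≤ s_r`. The matrices of corank `p` over `D` form a submanifold of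
codimension `p² dim D`, with Schur complements as defining functions
(`isSubmanifold_finrank_ker_eq`). For `D = ℝ` and `p = 1` more is true: the lowest `s_r` coefficients
of the characteristic polynomial vanish, and at a matrix of corank one these coefficients have
linearly independent differentials, because the coefficients of `adj (X - A) b` form a Jordan chain
of `A` (`isSubmanifold_charpoly`). That gives codimension `s_r`.

The preimages of these submanifolds under the jointly surjective maps `π_{i_r}` intersect
transversally (`IsSubmanifold.iInter_preimage`), and there is one such intersection for each of the
finitely many tuples of coranks.
-/

/-! ### Submanifolds cut out near each point by a submersion -/

namespace MonoidRep

open Topology Filter Function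

section Submanifolds

/-- A function that grows affinely with every possible slope along lines through `x` is a
submersion at `x`. -/
theorem fderiv_surjective_of_affine_lines {E F : Type*} [NormedAddCommGroup E] [NormedSpace ℝ E]
    [NormedAddCommGroup F] [NormedSpace ℝ F] {f : E → F} {x : E} (hf : DifferentiableAt ℝ f x)
    (h : ∀ w, ∃ v, ∀ t : ℝ, f (x + t • v) = f x + t • w) : Surjective (fderiv ℝ f x) := by
  intro w
  obtain ⟨v, hv⟩ := h w
  refine ⟨v, ?_⟩
  have h1 : HasLineDerivAt ℝ f (fderiv ℝ f x v) x v := hf.hasFDerivAt.hasLineDerivAt v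
  have h2 : HasLineDerivAt ℝ f w x v := by
    unfold HasLineDerivAt
    simp only [hv]
    simpa using ((hasDerivAt_id (0 : ℝ)).smul_const w).const_add (f x)
  exact h1.unique h2

/-- Being a submersion is an open condition. -/
theorem eventually_fderiv_surjective {E : Type*} [NormedAddCommGroup E] [NormedSpace ℝ E]
    {c : ℕ} {f : E → Fin c → ℝ} {x : E} (hf : ContDiffAt ℝ ∞ f x)
    (hs : Surjective (fderiv ℝ f x)) : ∀ᶠ y in 𝓝 x, Surjective (fderiv ℝ f y) := by
  obtain ⟨R, hR⟩ := (fderiv ℝ f x).toLinearMap.exists_rightInverse_of_surjective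
    (LinearMap.range_eq_top.2 hs)
  let R' : (Fin c → ℝ) →L[ℝ] E := LinearMap.toContinuousLinearMap R
  have hc : ContinuousAt (fun y => (fderiv ℝ f y).comp R') x :=
    ((hf.fderiv_right (m := 0) (by norm_num)).continuousAt).clm_comp continuousAt_const
  have hx : (fderiv ℝ f x).comp R' = 1 := by
    ext1 v
    exact congrArg (fun g => g v) hR
  have hU : {g : (Fin c → ℝ) →L[ℝ] (Fin c → ℝ) | IsUnit g} ∈ 𝓝 ((fderiv ℝ f x).comp R') :=
    Units.isOpen.mem_nhds (by rw [hx]; exact isUnit_one)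
  filter_upwards [hc hU] with y hy
  obtain ⟨g, hg⟩ := hy
  intro w
  refine ⟨R' ((↑g⁻¹ : (Fin c → ℝ) →L[ℝ] (Fin c → ℝ)) w), ?_⟩
  change ((fderiv ℝ f y).comp R') _ = w
  change _ = (fderiv ℝ f y).comp R' at hg
  rw [← hg]
  change ((g : (Fin c → ℝ) →L[ℝ] (Fin c → ℝ)) * ↑g⁻¹) w = w
  rw [g.mul_inv]
  rfl

/-- A set is a submanifold of codimension `c` if the germ of the set at each of its points is the
germ of the zero set of a smooth map to `ℝᶜ` that is a submersion at that point. -/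
theorem IsSubmanifold.of_germ {E : Type*} [NormedAddCommGroup E] [NormedSpace ℝ E]
    [FiniteDimensional ℝ E] {c : ℕ} {M : Set E}
    (h : ∀ x ∈ M, ∃ f : E → Fin c → ℝ, (∀ᶠ y in 𝓝 x, ContDiffAt ℝ ∞ f y) ∧
      Surjective (fderiv ℝ f x) ∧ ∀ᶠ y in 𝓝 x, (y ∈ M ↔ f y = 0)) : IsSubmanifold c M := by
  rintro e _ ⟨x, hx, rfl⟩
  obtain ⟨f, hf, hs, hM⟩ := h x hx
  let e' := e.toContinuousLinearEquiv
  have hs' := eventually_fderiv_surjective hf.self_of_nhds hs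
  obtain ⟨U, hU, hUo, hxU⟩ := eventually_nhds_iff.1 (hf.and (hs'.and hM))
  have hd : ∀ y ∈ U, HasFDerivAt (f ∘ e'.symm) ((fderiv ℝ f y).comp
      (e'.symm : (Fin (Module.finrank ℝ E) → ℝ) →L[ℝ] E)) (e y) := by
    intro y hy
    have h1 : HasFDerivAt f (fderiv ℝ f y) (e'.symm (e y)) := by
      have : e'.symm (e y) = y := e.symm_apply_apply y
      rw [this]
      exact ((hU y hy).1.differentiableAt (by simp)).hasFDerivAt
    exact h1.comp (e y) e'.symm.hasFDerivAt
  refine ⟨e'.symm ⁻¹' U, f ∘ e'.symm, hUo.preimage e'.symm.continuous, ?_, ?_, ?_, ?_⟩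
  · change e.symm (e x) ∈ U
    rwa [e.symm_apply_apply]
  · intro y hy
    exact ((hU _ hy).1.comp y e'.symm.contDiff.contDiffAt).contDiffWithinAt
  · intro y hy
    obtain ⟨z, rfl⟩ := e.surjective y
    have hz : z ∈ U := by
      have : e.symm (e z) ∈ U := hy
      rwa [e.symm_apply_apply] at this
    rw [(hd z hz).fderiv]
    exact (hU z hz).2.1.comp e'.symm.surjective
  · ext y
    obtain ⟨z, rfl⟩ := e.surjective y
    have hz : e'.symm (e z) = z := e.symm_apply_apply z
    simp only [Set.mem_inter_iff, Set.mem_preimage, Set.mem_ofPred_eq, comp_apply, hz,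
      e.injective.mem_set_image]
    constructor
    · exact fun ⟨h1, h2⟩ => ⟨h2, (hU z h2).2.2.1 h1⟩
    · exact fun ⟨h1, h2⟩ => ⟨(hU z h1).2.2.2 h2, h1⟩

/-- Submanifolds pulled back along linear maps that are jointly surjective intersect
transversally, so that their codimensions add up. -/
theorem IsSubmanifold.iInter_preimage {E : Type*} [AddCommGroup E] [Module ℝ E]
    [FiniteDimensional ℝ E] {k : ℕ} {G : Fin k → Type*} [∀ r, AddCommGroup (G r)]
    [∀ r, Module ℝ (G r)] [∀ r, FiniteDimensional ℝ (G r)] (π : ∀ r, E →ₗ[ℝ] G r)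
    (hπ : ∀ y : ∀ r, G r, ∃ x, ∀ r, π r x = y r) {d : Fin k → ℕ} {M : ∀ r, Set (G r)}
    (hM : ∀ r, IsSubmanifold (d r) (M r)) :
    IsSubmanifold (∑ r, d r) {x | ∀ r, π r x ∈ M r} := by
  rintro e _ ⟨x, hx, rfl⟩
  let b : ∀ r, G r ≃ₗ[ℝ] (Fin (Module.finrank ℝ (G r)) → ℝ) :=
    fun r => (Module.finBasis ℝ (G r)).equivFun
  let A : ∀ r, (Fin (Module.finrank ℝ E) → ℝ) →L[ℝ] (Fin (Module.finrank ℝ (G r)) → ℝ) :=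
    fun r => LinearMap.toContinuousLinearMap ((b r).toLinearMap ∘ₗ π r ∘ₗ e.symm.toLinearMap)
  have hA : ∀ r z, A r (e z) = b r (π r z) := by
    intro r z
    change b r (π r (e.symm (e z))) = _
    rw [e.symm_apply_apply]
  have hAs : ∀ y : ∀ r, Fin (Module.finrank ℝ (G r)) → ℝ, ∃ z, ∀ r, A r z = y r := by
    intro y
    obtain ⟨z, hz⟩ := hπ fun r => (b r).symm (y r)
    exact ⟨e z, fun r => by rw [hA, hz, LinearEquiv.apply_symm_apply]⟩
  choose U f hUo hxU hf hs hMU using fun r => hM r (b r) (b r (π r x)) ⟨_, hx r, rfl⟩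
  let Φ : (Fin (Module.finrank ℝ E) → ℝ) → (Σ r, Fin (d r)) → ℝ := fun y p => f p.1 (A p.1 y) p.2
  let F : (Fin (Module.finrank ℝ E) → ℝ) → Fin (∑ r, d r) → ℝ := fun y t =>
    Φ y (finSigmaFinEquiv.symm t)
  have hF : ∀ y r q, F y (finSigmaFinEquiv ⟨r, q⟩) = f r (A r y) q := fun y r q =>
    congrArg (Φ y) (finSigmaFinEquiv.symm_apply_apply ⟨r, q⟩)
  refine ⟨⋂ r, A r ⁻¹' U r, F, ?_, ?_, ?_, ?_, ?_⟩
  · exact isOpen_iInter_of_finite fun r => (hUo r).preimage (A r).continuous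
  · simp only [Set.mem_iInter, Set.mem_preimage, hA]
    exact hxU
  · rw [contDiffOn_pi]
    intro t
    obtain ⟨⟨r, q⟩, rfl⟩ := finSigmaFinEquiv.surjective t
    simp only [hF]
    have h1 : ContDiffOn ℝ ∞ (fun y => f r (A r y)) (⋂ r, A r ⁻¹' U r) :=
      (hf r).comp (A r).contDiff.contDiffOn (Set.iInter_subset _ r)
    exact contDiffOn_pi.1 h1 q
  · intro y hy w
    have hy' : ∀ r, A r y ∈ U r := by simpa using hy
    choose v hv using fun r => hs r (A r y) (hy' r) fun q => w (finSigmaFinEquiv ⟨r, q⟩)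
    obtain ⟨H, hH⟩ := hAs v
    refine ⟨H, ?_⟩
    have hdf : ∀ r, HasFDerivAt (f r) (fderiv ℝ (f r) (A r y)) (A r y) := fun r =>
      (((hf r).contDiffAt ((hUo r).mem_nhds (hy' r))).differentiableAt (by simp)).hasFDerivAt
    let D : (Σ r, Fin (d r)) → (Fin (Module.finrank ℝ E) → ℝ) →L[ℝ] ℝ := fun p =>
      (ContinuousLinearMap.proj (R := ℝ) (φ := fun _ => ℝ) p.2).comp
        ((fderiv ℝ (f p.1) (A p.1 y)).comp (A p.1))
    have hD : ∀ p, HasFDerivAt (fun y => Φ y p) (D p) y := fun p =>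
      hasFDerivAt_pi'.1 ((hdf p.1).comp y (A p.1).hasFDerivAt) p.2
    have hDH : ∀ p, D p H = w (finSigmaFinEquiv p) := by
      rintro ⟨r, q⟩
      change fderiv ℝ (f r) (A r y) (A r H) q = _
      rw [hH, hv]
    have hFD : HasFDerivAt F (ContinuousLinearMap.pi fun t => D (finSigmaFinEquiv.symm t)) y :=
      hasFDerivAt_pi.2 fun t => hD (finSigmaFinEquiv.symm t)
    rw [hFD.fderiv]
    ext t
    change D (finSigmaFinEquiv.symm t) H = w t
    rw [hDH, Equiv.apply_symm_apply]
  · ext y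
    obtain ⟨z, rfl⟩ := e.surjective y
    have key : ∀ r, b r (π r z) ∈ U r → (π r z ∈ M r ↔ f r (A r (e z)) = 0) := by
      intro r hr
      have := Set.ext_iff.1 (hMU r) (b r (π r z))
      simp only [Set.mem_inter_iff, (b r).injective.mem_set_image, Set.mem_ofPred_eq, hr, true_and,
        and_true] at this
      rw [this, hA]
    have hF0 : F (e z) = 0 ↔ ∀ r, f r (A r (e z)) = 0 := by
      constructor
      · intro h r
        ext q
        rw [← hF, h]
        rfl
      · intro h
        ext t
        obtain ⟨⟨r, q⟩, rfl⟩ := finSigmaFinEquiv.surjective t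
        rw [hF, h]
        rfl
    simp only [Set.mem_inter_iff, e.injective.mem_set_image, Set.mem_ofPred_eq, Set.mem_iInter,
      Set.mem_preimage, hA, hF0]
    constructor
    · exact fun ⟨h1, h2⟩ => ⟨h2, fun r => (hA r z) ▸ (key r (h2 r)).1 (h1 r)⟩
    · exact fun ⟨h1, h2⟩ => ⟨fun r => (key r (h1 r)).2 (by rw [hA]; exact h2 r), h1⟩

/-- The preimage of a submanifold under a surjective linear map is a submanifold of the same
codimension. -/
theorem IsSubmanifold.preimage {E G : Type*} [AddCommGroup E] [Module ℝ E]
    [FiniteDimensional ℝ E] [AddCommGroup G] [Module ℝ G] [FiniteDimensional ℝ G]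
    (π : E →ₗ[ℝ] G) (hπ : Surjective π) {d : ℕ} {M : Set G} (hM : IsSubmanifold d M) :
    IsSubmanifold d (π ⁻¹' M) := by
  have := IsSubmanifold.iInter_preimage (k := 1) (G := fun _ => G) (fun _ => π)
    (fun y => (hπ (y 0)).imp fun x hx r => by rw [hx, Subsingleton.elim r 0]) (fun _ => hM)
  simpa [Set.preimage] using this

end Submanifolds

end MonoidRep

/-! ### Endomorphisms with a kernel of given dimension -/

namespace MonoidRep

open Topology Filter Function

section RankStrata

/-- A chart for rank strata in a finite-dimensional algebra `B`. Near `x` the set `M` is described by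
a Schur complement: `x` is moved to an idempotent `e` by a unit `g`, and an element `y` near `x`
is normalized to `C = g y (e g y + (1 - e))⁻¹`, which satisfies `e C = e`. The map `Λ` with
section `σ` reads off the part `(1 - e) C (1 - e)`. -/
theorem isSubmanifold_of_schurComplement {B : Type*} [Ring B] [Algebra ℝ B]
    [FiniteDimensional ℝ B] {c : ℕ} {M : Set B}
    (h : ∀ x ∈ M, ∃ (g : Bˣ) (e : B) (Λ : B →ₗ[ℝ] (Fin c → ℝ)) (σ : (Fin c → ℝ) →ₗ[ℝ] B),
      g * x = e ∧ e * e = e ∧ Λ e = 0 ∧ (∀ w, e * σ w = 0) ∧ (∀ w, Λ (σ w) = w) ∧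
      ∀ (y : B) (z : Bˣ), (z : B) = e * (g * y) + (1 - e) → (y ∈ M ↔ Λ (g * y * ↑z⁻¹) = 0)) :
    IsSubmanifold c M := by
  let φ := Algebra.leftMulMatrix (Module.finBasis ℝ B)
  let : NormedRing (Matrix (Fin (Module.finrank ℝ B)) (Fin (Module.finrank ℝ B)) ℝ) :=
    Matrix.linftyOpNormedRing
  let : NormedAlgebra ℝ (Matrix (Fin (Module.finrank ℝ B)) (Fin (Module.finrank ℝ B)) ℝ) :=
    Matrix.linftyOpNormedAlgebra
  let : NormedRing B := NormedRing.induced B _ φ (Algebra.leftMulMatrix_injective _)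
  let : NormedAlgebra ℝ B := NormedAlgebra.induced ℝ B _ φ
  have : CompleteSpace B := FiniteDimensional.complete ℝ B
  refine IsSubmanifold.of_germ fun x hx => ?_
  obtain ⟨g, e, Λ, σ, hgx, hee, hΛe, heσ, hΛσ, hM⟩ := h x hx
  let Z : B → B := fun y => e * (g * y) + (1 - e)
  let f : B → Fin c → ℝ := fun y => Λ (g * y * Ring.inverse (Z y))
  have hZ : ContDiff ℝ ∞ Z := by fun_prop
  have hZx : Z x = 1 := by simp only [Z, hgx, hee]; abel
  have hZu : ∀ᶠ y in 𝓝 x, IsUnit (Z y) :=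
    hZ.continuous.continuousAt (Units.isOpen.mem_nhds (by rw [hZx]; exact isUnit_one))
  have hf : ∀ᶠ y in 𝓝 x, ContDiffAt ℝ ∞ f y := by
    filter_upwards [hZu] with y ⟨u, hu⟩
    have h1 : ContDiffAt ℝ ∞ (fun y => Ring.inverse (Z y)) y := by
      have h2 : ContDiffAt ℝ ∞ (Ring.inverse : B → B) (Z y) := by
        rw [← hu]
        exact contDiffAt_ringInverse ℝ u
      exact h2.comp y hZ.contDiffAt
    have h3 : ContDiffAt ℝ ∞ (fun y => g * y * Ring.inverse (Z y)) y := by fun_prop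
    exact (LinearMap.toContinuousLinearMap Λ).contDiff.contDiffAt.comp y h3
  refine ⟨f, hf, ?_, ?_⟩
  · refine fderiv_surjective_of_affine_lines (hf.self_of_nhds.differentiableAt (by simp))
      fun w => ⟨↑g⁻¹ * σ w, fun t => ?_⟩
    have h0 : (g : B) * (x + t • (↑g⁻¹ * σ w)) = e + t • σ w := by
      rw [mul_add, hgx, mul_smul_comm, Units.mul_inv_cancel_left]
    have h1 : Z (x + t • (↑g⁻¹ * σ w)) = 1 := by
      simp only [Z, h0, mul_add, hee, mul_smul_comm, heσ, smul_zero]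
      abel
    simp only [f, h0, h1, hZx, hgx, Ring.inverse_one, mul_one, map_add, map_smul, hΛσ]
  · filter_upwards [hZu] with y ⟨u, hu⟩
    rw [hM y u hu]
    simp only [f, ← hu, Ring.inverse_unit]

variable {D U : Type*} [DivisionRing D] [AddCommGroup U] [Module D U]

/-- Multiplying an endomorphism of a finite-dimensional space by a suitable automorphism turns it
into a projection along its kernel. -/
theorem exists_unit_mul_eq_projection [FiniteDimensional D U] (x : Module.End D U) :
    ∃ (g : (Module.End D U)ˣ) (P : U →ₗ[D] LinearMap.ker x),
      P ∘ₗ (LinearMap.ker x).subtype = LinearMap.id ∧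
      (g : Module.End D U) * x = 1 - (LinearMap.ker x).subtype ∘ₗ P := by
  obtain ⟨E, hE⟩ := (LinearMap.ker x).exists_isCompl
  obtain ⟨F', hF'⟩ := (LinearMap.range x).exists_isCompl
  have hdim : Module.finrank D (LinearMap.ker x) = Module.finrank D F' := by
    have h1 := Submodule.finrank_add_eq_of_isCompl hF'
    have h2 := x.finrank_range_add_finrank_ker
    omega
  let T : U ≃ₗ[D] U := (Submodule.prodEquivOfIsCompl E (LinearMap.ker x) hE.symm).symm ≪≫ₗ
    (LinearEquiv.prodCongr (x.kerComplementEquivRange hE.symm)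
      (LinearEquiv.ofFinrankEq _ _ hdim)) ≪≫ₗ Submodule.prodEquivOfIsCompl _ F' hF'
  have hT : ∀ v ∈ E, T v = x v := by
    intro v hv
    have h1 : (Submodule.prodEquivOfIsCompl E (LinearMap.ker x) hE.symm).symm v = (⟨v, hv⟩, 0) :=
      Submodule.prodEquivOfIsCompl_symm_apply_left _ _ _ ⟨v, hv⟩
    simp only [T, LinearEquiv.trans_apply, h1, LinearEquiv.prodCongr_apply, map_zero]
    simp [Submodule.coe_prodEquivOfIsCompl', LinearMap.kerComplementEquivRange]
  refine ⟨LinearMap.GeneralLinearGroup.ofLinearEquiv T.symm,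
    (LinearMap.ker x).projectionOnto E hE, ?_, ?_⟩
  · exact LinearMap.ext fun v => Submodule.projectionOnto_apply_left hE v
  · ext v
    obtain ⟨a, ha, b, hb, rfl⟩ := Submodule.mem_sup.1
      ((hE.sup_eq_top ▸ Submodule.mem_top : v ∈ LinearMap.ker x ⊔ E))
    have h1 : x a = 0 := ha
    have h2 : (LinearMap.ker x).projectionOnto E hE a = ⟨a, ha⟩ :=
      Submodule.projectionOnto_apply_left hE ⟨a, ha⟩
    have h3 : (LinearMap.ker x).projectionOnto E hE b = 0 :=
      Submodule.projectionOnto_apply_right hE ⟨b, hb⟩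
    change T.symm (x (a + b)) = (a + b) - ((LinearMap.ker x).projectionOnto E hE (a + b) : U)
    rw [map_add x, h1, zero_add, ← hT b hb, T.symm_apply_apply, map_add, h2, h3]
    simp

variable [Algebra ℝ D] [FiniteDimensional ℝ D] [Module ℝ U] [IsScalarTower ℝ D U]
  [SMulCommClass D ℝ U]

/-- The endomorphisms with a `p`-dimensional kernel form a submanifold whose codimension is the
real dimension of the space of `p × p` matrices. -/
theorem isSubmanifold_finrank_ker_eq [FiniteDimensional D U]
    [FiniteDimensional ℝ (Module.End D U)] (p : ℕ) :
    IsSubmanifold (p ^ 2 * Module.finrank ℝ D)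
      {x : Module.End D U | Module.finrank D (LinearMap.ker x) = p} := by
  refine isSubmanifold_of_schurComplement fun x hx => ?_
  obtain ⟨F, g, P, hF, hP, hg⟩ : ∃ (F : Submodule D U) (g : (Module.End D U)ˣ) (P : U →ₗ[D] F),
      F = LinearMap.ker x ∧ P ∘ₗ F.subtype = LinearMap.id ∧
      (g : Module.End D U) * x = 1 - F.subtype ∘ₗ P :=
    let ⟨g, P, h⟩ := exists_unit_mul_eq_projection x
    ⟨_, g, P, rfl, h⟩
  have hPv : ∀ v : F, P v = v := fun v => LinearMap.congr_fun hP v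
  have hFp : Module.finrank D F = p := hF ▸ hx
  have : Module.Finite ℝ F := Module.Finite.trans D F
  have hdim : Module.finrank ℝ (F →ₗ[D] F) = p ^ 2 * Module.finrank ℝ D := by
    let b := Module.finBasis D F
    rw [← (b.constr ℝ).finrank_eq, Module.finrank_pi_fintype, Finset.sum_const, Finset.card_univ,
      Fintype.card_fin, ← Module.finrank_mul_finrank ℝ D F, hFp]
    rw [smul_eq_mul]
    ring
  have : Module.Finite ℝ (F →ₗ[D] F) :=
    Module.Finite.equiv ((Module.finBasis D F).constr ℝ)
  let θ : (F →ₗ[D] F) ≃ₗ[ℝ] (Fin (p ^ 2 * Module.finrank ℝ D) → ℝ) :=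
    LinearEquiv.ofFinrankEq _ _ (by rw [hdim, Module.finrank_fin_fun])
  let Λ : Module.End D U →ₗ[ℝ] (F →ₗ[D] F) :=
    { toFun := fun C => P ∘ₗ C ∘ₗ F.subtype
      map_add' := fun C C' => by ext v; simp
      map_smul' := fun r C => by
        ext v
        simp only [LinearMap.coe_comp, comp_apply, LinearMap.smul_apply, RingHom.id_apply]
        rw [← algebraMap_smul D r (C _), map_smul, algebraMap_smul] }
  let σ : (F →ₗ[D] F) →ₗ[ℝ] Module.End D U :=
    { toFun := fun a => F.subtype ∘ₗ a ∘ₗ P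
      map_add' := fun C C' => by ext v; simp
      map_smul' := fun r C => by ext v; simp }
  have hev : ∀ v, (1 - F.subtype ∘ₗ P : Module.End D U) v = v - P v := fun v => rfl
  have heF : ∀ v : F, (1 - F.subtype ∘ₗ P : Module.End D U) v = 0 := fun v => by
    rw [hev, hPv, sub_self]
  refine ⟨g, 1 - F.subtype ∘ₗ P, θ.toLinearMap ∘ₗ Λ, σ ∘ₗ θ.symm.toLinearMap, hg, ?_, ?_, ?_, ?_,
    ?_⟩
  · ext v
    change (1 - F.subtype ∘ₗ P : Module.End D U) ((1 - F.subtype ∘ₗ P : Module.End D U) v) = _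
    rw [hev v, map_sub, heF, sub_zero, hev]
  · have : Λ (1 - F.subtype ∘ₗ P) = 0 := by
      ext1 v
      change P ((1 - F.subtype ∘ₗ P : Module.End D U) v) = 0
      rw [heF, map_zero]
    rw [LinearMap.comp_apply, this, map_zero]
  · intro w
    ext v
    exact heF _
  · intro w
    have : Λ (σ (θ.symm w)) = θ.symm w := by
      ext1 v
      change P ((θ.symm w (P v) : F) : U) = _
      rw [hPv, hPv]
    change θ (Λ (σ (θ.symm w))) = w
    rw [this, LinearEquiv.apply_symm_apply]
  · intro y z hz
    set e : Module.End D U := 1 - F.subtype ∘ₗ P with he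
    set C : Module.End D U := g * y * ↑z⁻¹ with hC
    have hee : e * e = e := by
      ext v
      change e (e v) = _
      rw [hev v, map_sub, heF, sub_zero, hev]
    have heC : e * C = e := by
      have : e * (g * y) = e * z := by
        rw [hz, mul_add, mul_sub, mul_one, hee, sub_self, add_zero, ← mul_assoc e e, hee]
      rw [hC, ← mul_assoc, this, mul_assoc, Units.mul_inv, mul_one]
    -- `C` arises from `y` by multiplication with units, so that the kernels have equal dimension
    have hCy : Module.finrank D (LinearMap.ker C) = Module.finrank D (LinearMap.ker y) := by
      let ζ := LinearMap.GeneralLinearGroup.toLinearEquiv z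
      have hζ : ∀ v, (↑z⁻¹ : Module.End D U) (ζ v) = v := fun v =>
        LinearMap.congr_fun z.inv_mul v
      have hζ' : ∀ v, ζ ((↑z⁻¹ : Module.End D U) v) = v := fun v =>
        LinearMap.congr_fun z.mul_inv v
      have hg' : ∀ v, (g : Module.End D U) v = 0 → v = 0 := fun v hv => by
        have h1 : ((↑g⁻¹ : Module.End D U) * g) v = 0 :=
          (congrArg (↑g⁻¹ : Module.End D U) hv).trans (map_zero _)
        rwa [g.inv_mul] at h1
      have h1 : LinearMap.ker C = (LinearMap.ker y).map (ζ : U →ₗ[D] U) := by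
        ext v
        constructor
        · exact fun hv => ⟨(↑z⁻¹ : Module.End D U) v, hg' _ hv, hζ' v⟩
        · rintro ⟨w, hw, rfl⟩
          change (g : Module.End D U) (y ((↑z⁻¹ : Module.End D U) (ζ w))) = 0
          rw [hζ, LinearMap.mem_ker.1 hw, map_zero]
      rw [h1]
      exact (ζ.submoduleMap (LinearMap.ker y)).finrank_eq.symm
    have hle : LinearMap.ker C ≤ F := by
      intro v hv
      have h1 : e v = 0 := by
        rw [← heC]
        change e (C v) = 0
        rw [LinearMap.mem_ker.1 hv, map_zero]
      rw [hev, sub_eq_zero] at h1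
      rw [h1]
      exact (P v).2
    change Module.finrank D (LinearMap.ker y) = p ↔ θ (Λ C) = 0
    rw [LinearEquiv.map_eq_zero_iff, ← hCy]
    constructor
    · intro h
      have h1 : LinearMap.ker C = F := Submodule.eq_of_le_of_finrank_eq hle (h.trans hFp.symm)
      ext1 v
      have h2 : C v = 0 := LinearMap.mem_ker.1 (h1.ge v.2)
      change P (C v) = 0
      rw [h2, map_zero]
    · intro h
      rw [← hFp]
      refine congrArg (fun W : Submodule D U => Module.finrank D W) (le_antisymm hle fun v hv => ?_)
      have h1 : P (C v) = 0 := LinearMap.congr_fun h ⟨v, hv⟩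
      have h2 : e (C v) = 0 := by
        change (e * C) v = 0
        rw [heC]
        exact heF ⟨v, hv⟩
      rw [hev, h1, Submodule.coe_zero, sub_zero] at h2
      exact h2

end RankStrata

end MonoidRep

/-! ### Real matrices of corank one with prescribed nilpotent part -/

namespace MonoidRep

open Topology Filter Function Matrix Polynomial

section Charpoly

variable {n : Type*} [Fintype n] [DecidableEq n]

/-- The matrix determinant lemma in terms of the adjugate. -/
theorem det_add_vecMulVec_of_ne_zero {R : Type*} [CommRing R] [IsDomain R] {A : Matrix n n R}
    (hA : A.det ≠ 0) (u v : n → R) :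
    (A + vecMulVec u v).det = A.det + v ⬝ᵥ (A.adjugate *ᵥ u) := by
  let K := FractionRing R
  let φ := algebraMap R K
  have hφ : Injective φ := IsFractionRing.injective R K
  apply hφ
  have hdet : (φ.mapMatrix A).det ≠ 0 := by
    rw [← RingHom.map_det]
    exact fun h => hA (hφ (h.trans (map_zero φ).symm))
  have hu := isUnit_iff_ne_zero.2 hdet
  have h1 := det_add_replicateCol_mul_replicateRow (ι := Unit) hu (φ ∘ u) (φ ∘ v)
  have h2 : φ.mapMatrix (A + vecMulVec u v) =
      φ.mapMatrix A + replicateCol Unit (φ ∘ u) * replicateRow Unit (φ ∘ v) := by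
    ext i j
    simp [vecMulVec_apply, Matrix.mul_apply]
  have h3 : φ (v ⬝ᵥ (A.adjugate *ᵥ u)) =
      (φ ∘ v) ⬝ᵥ ((φ.mapMatrix A).adjugate *ᵥ (φ ∘ u)) := by
    rw [RingHom.map_dotProduct, ← RingHom.map_adjugate]
    congr 1
    ext i
    simp [RingHom.map_mulVec]
  have h4 : (1 + replicateRow Unit (φ ∘ v) * (φ.mapMatrix A)⁻¹ *
      replicateCol Unit (φ ∘ u)).det = 1 + (φ ∘ v) ⬝ᵥ ((φ.mapMatrix A)⁻¹ *ᵥ (φ ∘ u)) := by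
    rw [det_unique, Matrix.mul_assoc]
    rfl
  rw [RingHom.map_det, h2, h1, map_add, h3, RingHom.map_det, h4, mul_add, mul_one]
  congr 1
  rw [Matrix.inv_def, Ring.inverse_eq_inv', Matrix.smul_mulVec, dotProduct_smul, smul_eq_mul,
    mul_inv_cancel_left₀ hdet]

/-- The polynomial vector `adj (X - A) b`, whose coefficients are the derivatives of the
coefficients of the characteristic polynomial of `A` along the matrices `b vᵀ`. -/
noncomputable def adjugateVec (A : Matrix n n ℝ) (b : n → ℝ) : n → ℝ[X] :=
  A.charmatrix.adjugate *ᵥ fun i => C (b i)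

/-- The coefficients of the characteristic polynomial are affine along the matrices `b vᵀ`. -/
theorem charpoly_coeff_add_vecMulVec (A : Matrix n n ℝ) (b v : n → ℝ) (k : ℕ) :
    (A + vecMulVec b v).charpoly.coeff k =
      A.charpoly.coeff k - v ⬝ᵥ fun i => (adjugateVec A b i).coeff k := by
  have h1 : (A + vecMulVec b v).charmatrix =
      A.charmatrix + vecMulVec (fun i => C (b i)) (fun i => C (-v i)) := by
    ext i j : 2
    simp only [charmatrix_apply, vecMulVec_apply, Matrix.add_apply, map_add, map_mul, map_neg]
    rw [mul_neg, ← sub_eq_add_neg, sub_sub]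
  rw [charpoly, h1, det_add_vecMulVec_of_ne_zero (A.charpoly_monic.ne_zero)]
  change (A.charpoly + (fun i => C (-v i)) ⬝ᵥ adjugateVec A b).coeff k = _
  simp only [coeff_add, dotProduct, finsetSum_coeff, coeff_C_mul, neg_mul, Finset.sum_neg_distrib,
    sub_eq_add_neg]

/-- The identity `(X - A) adj (X - A) b = χ b`. Its coefficients show that `A` lowers the index of the
coefficients of `adj (X - A) b` as long as the coefficients of `χ` vanish. -/
theorem X_mul_adjugateVec (A : Matrix n n ℝ) (b : n → ℝ) (i : n) :
    X * adjugateVec A b i - ∑ l, C (A i l) * adjugateVec A b l = A.charpoly * C (b i) := by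
  have h1 : A.charmatrix *ᵥ adjugateVec A b = A.charpoly • fun i => C (b i) := by
    rw [adjugateVec, mulVec_mulVec, mul_adjugate, smul_mulVec, one_mulVec]
    rfl
  have h2 := congrFun h1 i
  rw [charmatrix, sub_mulVec, Pi.sub_apply, scalar_apply, mulVec_diagonal] at h2
  exact h2

theorem mulVec_coeff_adjugateVec (A : Matrix n n ℝ) (b : n → ℝ) (k : ℕ) :
    A *ᵥ (fun i => (adjugateVec A b i).coeff (k + 1)) =
      (fun i => (adjugateVec A b i).coeff k) - A.charpoly.coeff (k + 1) • b := by
  ext i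
  have h := congrArg (fun p => coeff p (k + 1)) (X_mul_adjugateVec A b i)
  simp only [coeff_sub, coeff_X_mul, finsetSum_coeff, coeff_C_mul, coeff_mul_C] at h
  simp only [mulVec, dotProduct, Pi.sub_apply, Pi.smul_apply, smul_eq_mul]
  linarith

theorem mulVec_coeff_zero_adjugateVec (A : Matrix n n ℝ) (b : n → ℝ) :
    A *ᵥ (fun i => (adjugateVec A b i).coeff 0) = -(A.charpoly.coeff 0 • b) := by
  ext i
  have h := congrArg (fun p => coeff p 0) (X_mul_adjugateVec A b i)
  simp only [coeff_sub, coeff_X_mul_zero, finsetSum_coeff, coeff_C_mul, coeff_mul_C] at h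
  simp only [mulVec, dotProduct, Pi.neg_apply, Pi.smul_apply, smul_eq_mul]
  linarith

theorem coeff_zero_adjugateVec (A : Matrix n n ℝ) (b : n → ℝ) :
    (fun i => (adjugateVec A b i).coeff 0) = (-A).adjugate *ᵥ b := by
  have h1 : (constantCoeff (R := ℝ)).mapMatrix A.charmatrix = -A := by
    ext i j
    simp [charmatrix_apply, Matrix.diagonal_apply]
    split_ifs <;> simp
  ext i
  rw [← h1, ← RingHom.map_adjugate]
  change constantCoeff (adjugateVec A b i) = _
  rw [adjugateVec, RingHom.map_mulVec]
  simp [comp_def]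

/-- A chain of vectors on which an operator acts as a nilpotent Jordan block is linearly
independent. -/
theorem linearIndependent_jordan_chain {E : Type*} [AddCommGroup E] [Module ℝ E] (T : E →ₗ[ℝ] E)
    (a : ℕ → E) (h0 : a 0 ≠ 0) (s : ℕ) (hT0 : 0 < s → T (a 0) = 0)
    (hT : ∀ k, k + 1 < s → T (a (k + 1)) = a k) :
    LinearIndependent ℝ fun k : Fin s => a k := by
  induction s with
  | zero => exact linearIndependent_empty_type
  | succ s ih =>
    replace hT0 := hT0 (Nat.succ_pos s)
    have hpow : ∀ k, k < s + 1 → (T ^ k) (a k) = a 0 := by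
      intro k
      induction k with
      | zero => exact fun _ => rfl
      | succ k ihk =>
        intro hk
        rw [pow_succ, Module.End.mul_apply, hT k hk, ihk (by omega)]
    have hpow0 : ∀ k < s, (T ^ s) (a k) = 0 := by
      intro k hk
      obtain ⟨l, rfl⟩ := Nat.exists_eq_add_of_le (Nat.succ_le_of_lt hk)
      rw [show k.succ + l = l + 1 + k by omega, pow_add, Module.End.mul_apply,
        hpow k (by omega), pow_succ, Module.End.mul_apply, hT0, map_zero]
    rw [linearIndependent_finSucc']
    refine ⟨ih (fun _ => hT0) fun k hk => hT k (by omega), fun h => h0 ?_⟩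
    rw [← hpow s (by omega)]
    have hle : Submodule.span ℝ (Set.range (Fin.init fun k : Fin (s + 1) => a k)) ≤
        LinearMap.ker (T ^ s) := by
      rw [Submodule.span_le]
      rintro _ ⟨k, rfl⟩
      exact hpow0 k k.2
    exact hle h

theorem contDiffAt_charpoly_coeff {E : Type*} [NormedAddCommGroup E] [NormedSpace ℝ E]
    [FiniteDimensional ℝ E] (L : E →ₗ[ℝ] Matrix n n ℝ) (k : ℕ) (x : E) :
    ContDiffAt ℝ ∞ (fun y => (L y).charpoly.coeff k) x := by
  let L' : n × n → E →ₗ[ℝ] ℝ := fun p =>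
    LinearMap.proj p.2 ∘ₗ LinearMap.proj p.1 ∘ₗ (Matrix.ofLinearEquiv ℝ).symm.toLinearMap ∘ₗ L
  have h := (AnalyticOnNhd.eval_linearMap' L' ((charpoly.univ ℝ n).coeff k)) x (Set.mem_univ x)
  have h1 : (fun y => MvPolynomial.eval (L' · y) ((charpoly.univ ℝ n).coeff k)) =
      fun y => (L y).charpoly.coeff k := by
    ext y
    exact charpoly.univ_coeff_eval₂Hom n (RingHom.id ℝ) (fun p => L y p.1 p.2) k
  rw [h1] at h
  exact h.contDiffAt

theorem exists_dotProduct_eq {n : Type*} [Fintype n] {s : ℕ} {a : Fin s → n → ℝ}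
    (ha : LinearIndependent ℝ a) (w : Fin s → ℝ) : ∃ v, ∀ k, v ⬝ᵥ a k = w k := by
  classical
  obtain ⟨R, hR⟩ := (Fintype.linearCombination ℝ a).exists_leftInverse_of_injective
    (LinearMap.ker_eq_bot.2 (linearIndependent_iff_injective_fintypeLinearCombination.1 ha))
  refine ⟨w ᵥ* LinearMap.toMatrix' R, fun k => ?_⟩
  have h1 := LinearMap.congr_fun hR (Pi.single k 1)
  simp only [LinearMap.comp_apply, Fintype.linearCombination_apply_single, one_smul,
    LinearMap.id_apply] at h1
  rw [← dotProduct_mulVec, LinearMap.toMatrix'_mulVec, h1, dotProduct_single, mul_one]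

/-- The matrices of corank at most one whose characteristic polynomial is divisible by `X ^ s` form
a submanifold of codimension `s`. -/
theorem isSubmanifold_charpoly (s : ℕ) :
    IsSubmanifold s {A : Matrix n n ℝ | (-A).adjugate ≠ 0 ∧ ∀ k < s, A.charpoly.coeff k = 0} := by
  -- the entries serve as coordinates on the space of matrices, which carries no norm
  let L : (n → n → ℝ) ≃ₗ[ℝ] Matrix n n ℝ := Matrix.ofLinearEquiv ℝ
  suffices h : IsSubmanifold s {B : n → n → ℝ | (-L B).adjugate ≠ 0 ∧
      ∀ k < s, (L B).charpoly.coeff k = 0} from h.preimage L.symm.toLinearMap L.symm.surjective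
  refine IsSubmanifold.of_germ ?_
  rintro B ⟨hA, hs⟩
  have hsm : ∀ B : n → n → ℝ, ContDiffAt ℝ ∞ (fun B => fun k : Fin s => (L B).charpoly.coeff k) B :=
    fun B => contDiffAt_pi.2 fun k => contDiffAt_charpoly_coeff L.toLinearMap k B
  refine ⟨fun B k => (L B).charpoly.coeff k, Eventually.of_forall hsm, ?_, ?_⟩
  · obtain ⟨b, hb⟩ : ∃ b, (-L B).adjugate *ᵥ b ≠ 0 := by
      by_contra! h
      exact hA (Matrix.ext_of_mulVec_single fun i => by rw [h, zero_mulVec])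
    let A := L B
    replace hs : ∀ k < s, A.charpoly.coeff k = 0 := hs
    let a : ℕ → n → ℝ := fun k i => (adjugateVec A b i).coeff k
    have hli : LinearIndependent ℝ fun k : Fin s => a k := by
      refine linearIndependent_jordan_chain A.mulVecLin a ?_ s ?_ ?_
      · simpa only [a, coeff_zero_adjugateVec] using hb
      · intro h
        simp only [a, mulVecLin_apply, mulVec_coeff_zero_adjugateVec, hs 0 h, zero_smul, neg_zero]
      · intro k hk
        simp only [a, mulVecLin_apply, mulVec_coeff_adjugateVec, hs _ hk, zero_smul, sub_zero]
    refine fderiv_surjective_of_affine_lines ((hsm B).differentiableAt (by simp)) fun w => ?_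
    obtain ⟨v, hv⟩ := exists_dotProduct_eq hli fun k => -w k
    refine ⟨L.symm (vecMulVec b v), fun t => ?_⟩
    ext k
    have h2 : (v ⬝ᵥ fun i => (adjugateVec A b i).coeff k) = -w k := hv k
    rw [map_add, map_smul, L.apply_symm_apply]
    change (A + t • vecMulVec b v).charpoly.coeff k = A.charpoly.coeff k + t * w k
    rw [← vecMulVec_smul, charpoly_coeff_add_vecMulVec, smul_dotProduct, h2]
    simp
  · have hcont : Continuous fun B : n → n → ℝ => (-(Matrix.of B)).adjugate :=
      continuous_id.neg.matrix_adjugate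
    filter_upwards [hcont.continuousAt.eventually_ne hA] with B hB
    simp only [funext_iff, Fin.forall_iff, Pi.zero_apply]
    exact and_iff_right hB

/-- A matrix of corank one has a nonzero adjugate. -/
theorem adjugate_neg_ne_zero {A : Matrix n n ℝ} {y₀ : n → ℝ} (h0 : y₀ ≠ 0) (hA : y₀ ᵥ* A = 0)
    (h : ∀ y, y ᵥ* A = 0 → ∃ c : ℝ, c • y₀ = y) : (-A).adjugate ≠ 0 := by
  intro hadj
  have hns : ¬ Surjective A.vecMulLinear := by
    intro hs
    exact h0 (LinearMap.injective_iff_surjective.2 hs (hA.trans (map_zero A.vecMulLinear).symm))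
  obtain ⟨v, hv⟩ := not_forall.1 hns
  have hy : y₀ ⬝ᵥ y₀ ≠ 0 := fun h => h0 (dotProduct_self_eq_zero.1 h)
  -- a rank one perturbation by a vector outside the range makes `A` invertible
  have hdet : (A + vecMulVec y₀ v).det ≠ 0 := by
    intro hd
    obtain ⟨y, hy0, hyA⟩ := exists_vecMul_eq_zero_iff.2 hd
    rw [vecMul_add, vecMul_vecMulVec] at hyA
    have h1 : y ⬝ᵥ y₀ = 0 := by
      by_contra hne
      refine hv ⟨-(y ⬝ᵥ y₀)⁻¹ • y, ?_⟩
      rw [map_smul, vecMulLinear_apply, eq_neg_of_add_eq_zero_left hyA]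
      simp [smul_smul, hne]
    rw [h1] at hyA
    obtain ⟨c, rfl⟩ := h y (by simpa using hyA)
    rw [smul_dotProduct, smul_eq_mul, mul_eq_zero, or_iff_left hy] at h1
    exact hy0 (by rw [h1, zero_smul])
  have hA0 : A.det = 0 := exists_vecMul_eq_zero_iff.1 ⟨y₀, h0, hA⟩
  rw [det_eq_sign_charpoly_coeff, mul_eq_zero, or_iff_right (by simp)] at hA0
  refine hdet ?_
  rw [det_eq_sign_charpoly_coeff, charpoly_coeff_add_vecMulVec, hA0, coeff_zero_adjugateVec, hadj]
  simp

/-- If `A` acts nilpotently on an `s`-dimensional invariant subspace, then `X ^ s` divides its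
characteristic polynomial. -/
theorem charpoly_coeff_eq_zero {s : ℕ} {A : Matrix n n ℝ} {u : Matrix n (Fin s) ℝ}
    {v : Matrix (Fin s) n ℝ} {N : Matrix (Fin s) (Fin s) ℝ} (hvu : v * u = 1)
    (hAu : A * u = u * N) (hN : IsNilpotent N) : ∀ k < s, A.charpoly.coeff k = 0 := by
  intro k hk
  obtain ⟨m, hm⟩ := hN
  have hpow : ∀ m, A ^ m * u = u * N ^ m := by
    intro m
    induction m with
    | zero => simp
    | succ m ih => rw [pow_succ, Matrix.mul_assoc, hAu, ← Matrix.mul_assoc, ih, Matrix.mul_assoc,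
        ← pow_succ]
  have hmem : ∀ w, u.mulVecLin w ∈ Module.End.maxGenEigenspace (toLin' A) 0 := by
    intro w
    rw [Module.End.mem_maxGenEigenspace]
    refine ⟨m, ?_⟩
    rw [zero_smul, sub_zero, ← toLin'_pow, toLin'_apply, mulVecLin_apply, mulVec_mulVec, hpow, hm,
      Matrix.mul_zero, zero_mulVec]
  have hinj : Injective (u.mulVecLin.codRestrict _ hmem) := by
    intro w w' h
    have h1 : u *ᵥ w = u *ᵥ w' := congrArg Subtype.val h
    have h2 := congrArg (v *ᵥ ·) h1
    simpa [mulVec_mulVec, hvu] using h2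
  have h1 := LinearMap.finrank_le_finrank_of_injective hinj
  rw [Module.finrank_fin_fun, LinearMap.finrank_maxGenEigenspace_zero_eq, charpoly_toLin'] at h1
  exact coeff_eq_zero_of_lt_natTrailingDegree (hk.trans_le h1)

end Charpoly

end MonoidRep

/-! ### Dimensions of real division algebras -/

namespace MonoidRep

open Function

section Frobenius

variable {D : Type*} [DivisionRing D] [Algebra ℝ D] [FiniteDimensional ℝ D]

/-- An element of a finite-dimensional real division algebra is real or lies in a copy of `ℂ`. -/
theorem exists_eq_algebraMap_or_exists_sq_eq_neg_one (x : D) :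
    (∃ r : ℝ, x = algebraMap ℝ D r) ∨
      ∃ (j : D) (a b : ℝ), j * j = -1 ∧ b ≠ 0 ∧ x = algebraMap ℝ D a + b • j := by
  have hint : IsIntegral ℝ x := Algebra.IsIntegral.isIntegral x
  have hdeg := (minpoly.irreducible hint).natDegree_le_two
  have hpos := minpoly.natDegree_pos hint
  by_cases h1 : (minpoly ℝ x).natDegree = 1
  · obtain ⟨r, hr⟩ := minpoly.natDegree_eq_one_iff.1 h1
    exact Or.inl ⟨r, hr.symm⟩
  have h2 : (minpoly ℝ x).natDegree = 2 := by omega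
  obtain ⟨c, d, hcd⟩ : ∃ c d : ℝ, x * x + c • x + d • 1 = 0 := by
    refine ⟨(minpoly ℝ x).coeff 1, (minpoly ℝ x).coeff 0, ?_⟩
    have h3 : (minpoly ℝ x).coeff 2 = 1 := h2 ▸ (minpoly.monic hint).coeff_natDegree
    have h4 := minpoly.aeval ℝ x
    rw [Polynomial.eq_quadratic_of_degree_le_two (minpoly.irreducible hint).degree_le_two, h3] at h4
    simpa [Algebra.smul_def, pow_two] using h4
  -- completing the square
  set y := x + (c / 2) • (1 : D) with hy
  have hyy : y * y = (c ^ 2 / 4 - d) • (1 : D) := by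
    have h3 : x * x = -(c • x + d • 1) := by
      rw [add_assoc] at hcd
      exact eq_neg_of_add_eq_zero_left hcd
    simp only [hy, mul_add, add_mul, h3, mul_smul_comm, smul_mul_assoc, mul_one, one_mul]
    module
  have hxy : x = y - (c / 2) • (1 : D) := by rw [hy, add_sub_cancel_right]
  rcases le_or_gt 0 (c ^ 2 / 4 - d) with h | h
  · left
    have h3 : (y - √(c ^ 2 / 4 - d) • (1 : D)) * (y + √(c ^ 2 / 4 - d) • (1 : D)) = 0 := by
      have h4 := Real.mul_self_sqrt h
      generalize √(c ^ 2 / 4 - d) = e at h4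
      have h5 : (y - e • (1 : D)) * (y + e • (1 : D)) = y * y - (e * e) • (1 : D) := by
        simp only [mul_add, sub_mul, mul_smul_comm, smul_mul_assoc, mul_one, one_mul]
        module
      rw [h5, h4, hyy, sub_self]
    rcases mul_eq_zero.1 h3 with h4 | h4
    · refine ⟨√(c ^ 2 / 4 - d) - c / 2, ?_⟩
      rw [hxy, sub_eq_zero.1 h4, Algebra.algebraMap_eq_smul_one, sub_smul]
    · refine ⟨-√(c ^ 2 / 4 - d) - c / 2, ?_⟩
      rw [hxy, eq_neg_of_add_eq_zero_left h4, Algebra.algebraMap_eq_smul_one, sub_smul, neg_smul]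
  · right
    have h0 : 0 < -(c ^ 2 / 4 - d) := by linarith
    have hs : √(-(c ^ 2 / 4 - d)) ≠ 0 := (Real.sqrt_pos.2 h0).ne'
    refine ⟨(√(-(c ^ 2 / 4 - d)))⁻¹ • y, -(c / 2), √(-(c ^ 2 / 4 - d)), ?_, hs, ?_⟩
    · rw [smul_mul_smul_comm, hyy, smul_smul, ← mul_inv, Real.mul_self_sqrt h0.le, inv_neg,
        neg_mul, inv_mul_cancel₀ h.ne, neg_one_smul]
    · rw [smul_inv_smul₀ hs, hxy, Algebra.algebraMap_eq_smul_one, neg_smul]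
      abel

/-- Frobenius: the dimension of a finite-dimensional real division algebra is `1`, `2` or `4`. -/
theorem finrank_divisionRing :
    Module.finrank ℝ D = 1 ∨ Module.finrank ℝ D = 2 ∨ Module.finrank ℝ D = 4 := by
  by_cases hreal : ∀ x : D, ∃ r : ℝ, x = algebraMap ℝ D r
  · left
    rw [finrank_eq_one_iff']
    exact ⟨1, one_ne_zero, fun x => (hreal x).imp fun r hr => by
      rw [hr, Algebra.algebraMap_eq_smul_one]⟩
  right
  obtain ⟨x₀, hx₀⟩ := not_forall.1 hreal
  obtain ⟨i, -, -, hi, -, -⟩ := (exists_eq_algebraMap_or_exists_sq_eq_neg_one x₀).resolve_left hx₀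
  have hi0 : i ≠ 0 := by
    rintro rfl
    simp at hi
  -- conjugation by `i` splits `D` into the centralizer `p` of `i` and a complement `q`
  let p : Submodule ℝ D := LinearMap.ker (LinearMap.mulLeft ℝ i - LinearMap.mulRight ℝ i)
  let q : Submodule ℝ D := LinearMap.ker (LinearMap.mulLeft ℝ i + LinearMap.mulRight ℝ i)
  have hp : ∀ x, x ∈ p ↔ i * x = x * i := fun x => by
    simp [p, sub_eq_zero]
  have hq : ∀ x, x ∈ q ↔ i * x = -(x * i) := fun x => by
    simp [q, add_eq_zero_iff_eq_neg]
  have hpq : IsCompl p q := by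
    constructor
    · rw [Submodule.disjoint_def]
      intro x h1 h2
      rw [hp] at h1
      rw [hq, h1] at h2
      have h3 : (2 : ℝ) • (x * i) = 0 := by
        rw [two_smul]
        exact eq_neg_iff_add_eq_zero.1 h2
      exact (mul_eq_zero.1 ((smul_eq_zero.1 h3).resolve_left two_ne_zero)).resolve_right hi0
    · rw [codisjoint_iff_le_sup]
      intro x _
      have h1 : x = (1 / 2 : ℝ) • (x - i * x * i) + (1 / 2 : ℝ) • (x + i * x * i) := by
        module
      rw [h1]
      refine Submodule.add_mem_sup (p.smul_mem _ ?_) (q.smul_mem _ ?_)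
      · rw [hp, mul_sub, sub_mul, ← mul_assoc, ← mul_assoc, hi, mul_assoc _ i i, hi]
        simp [add_comm]
      · rw [hq, mul_add, add_mul, ← mul_assoc, ← mul_assoc, hi, mul_assoc _ i i, hi]
        simp
  have hp2 : Module.finrank ℝ p = 2 := by
    have hmem : ∀ z : ℝ × ℝ, (LinearMap.toSpanSingleton ℝ D 1).coprod
        (LinearMap.toSpanSingleton ℝ D i) z ∈ p := by
      intro z
      rw [hp]
      simp [mul_add, add_mul]
    have hb : Bijective (LinearMap.codRestrict p _ hmem) := by
      constructor
      · rw [← LinearMap.ker_eq_bot, LinearMap.ker_eq_bot']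
        rintro ⟨a, b⟩ h
        have h1 : a • (1 : D) + b • i = 0 := congrArg Subtype.val h
        have h2 : a • (1 : D) = -(b • i) := eq_neg_of_add_eq_zero_left h1
        have h3 : (a * a + b * b) • (1 : D) = 0 := by
          have h4 : (a • (1 : D)) * (a • (1 : D)) = (-(b • i)) * (-(b • i)) := by rw [h2]
          rw [neg_mul_neg, smul_mul_smul_comm, smul_mul_smul_comm, hi, mul_one, smul_neg] at h4
          rw [add_smul, h4, neg_add_cancel]
        have h4 : a * a + b * b = 0 := (smul_eq_zero.1 h3).resolve_right one_ne_zero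
        ext <;> simp <;> nlinarith
      · rintro ⟨x, hx⟩
        rw [hp] at hx
        rcases exists_eq_algebraMap_or_exists_sq_eq_neg_one x with ⟨r, rfl⟩ | ⟨j, a, b, hj, hb, rfl⟩
        · refine ⟨(r, 0), Subtype.ext ?_⟩
          simp [Algebra.algebraMap_eq_smul_one]
        · have hij : i * j = j * i := by
            rw [mul_add, add_mul, Algebra.commutes, add_right_inj, mul_smul_comm,
              smul_mul_assoc] at hx
            exact smul_right_injective D hb hx
          have h1 : (j - i) * (j + i) = 0 := by
            rw [mul_add, sub_mul, sub_mul, hj, hi, hij]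
            abel
          rcases mul_eq_zero.1 h1 with h | h
          · refine ⟨(a, b), Subtype.ext ?_⟩
            simp [Algebra.algebraMap_eq_smul_one, sub_eq_zero.1 h]
          · refine ⟨(a, -b), Subtype.ext ?_⟩
            simp [Algebra.algebraMap_eq_smul_one, eq_neg_of_add_eq_zero_left h]
    rw [← (LinearEquiv.ofBijective _ hb).finrank_eq]
    simp
  have hsum := Submodule.finrank_add_eq_of_isCompl hpq
  by_cases hq0 : q = ⊥
  · left
    rw [hq0, finrank_bot] at hsum
    omega
  · right
    obtain ⟨y, hy, hy0⟩ := Submodule.exists_mem_ne_zero_of_ne_bot hq0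
    rw [hq] at hy
    -- right multiplication by `y ∈ q` interchanges `p` and `q`
    have h1 : q = p.map (LinearMap.mulRight ℝ y) := by
      ext x
      constructor
      · intro hx
        rw [hq] at hx
        refine ⟨x * y⁻¹, (hp _).2 ?_, by simp [hy0]⟩
        have h2 : y⁻¹ * i = -(i * y⁻¹) := by
          calc y⁻¹ * i = y⁻¹ * (i * y) * y⁻¹ := by
                rw [mul_assoc, mul_assoc, mul_inv_cancel₀ hy0, mul_one]
            _ = -(i * y⁻¹) := by rw [hy, mul_neg, inv_mul_cancel_left₀ hy0, neg_mul]
        rw [← mul_assoc, hx, mul_assoc x, h2, mul_neg, neg_mul, mul_assoc]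
      · rintro ⟨z, hz, rfl⟩
        have hz' := (hp z).1 hz
        rw [hq, LinearMap.mulRight_apply, ← mul_assoc, hz', mul_assoc, hy, mul_neg, mul_assoc]
    have h2 : Module.finrank ℝ q = Module.finrank ℝ p := by
      rw [h1]
      exact (Submodule.equivMapOfInjective _ (mul_left_injective₀ hy0) p).finrank_eq.symm
    omega

end Frobenius

end MonoidRep

/-! ### The residue division algebra of an indecomposable representation -/

namespace MonoidRep

open Function Representation

section Residue

universe u

variable {S V : Type*} [Monoid S] [AddCommGroup V] [Module ℝ V]

/-- The ring structure on the endomorphisms, assembled from the semiring and the additive group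
structures of intertwining maps. -/
instance instRingEnd (ρ : Representation ℝ S V) : Ring (End ρ) :=
  { (inferInstance : Semiring (End ρ)), (inferInstance : AddCommGroup (End ρ)) with }

variable {ρ : Representation ℝ S V}

theorem isUnit_of_bijective {L : End ρ} (hL : Bijective L.toLinearMap) : IsUnit L := by
  let e := L.ofBijective hL
  have h1 : L * e.symm.toIntertwiningMap = 1 := by
    ext v
    exact e.apply_symm_apply v
  have h2 : e.symm.toIntertwiningMap * L = 1 := by
    ext v
    exact e.symm_apply_apply v
  exact ⟨⟨L, e.symm.toIntertwiningMap, h1, h2⟩, rfl⟩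

theorem not_injective_of_isNilpotent [Nontrivial V] {L : End ρ} (hL : IsNilpotent L) :
    ¬ Injective L.toLinearMap := by
  intro hi
  obtain ⟨n, hn⟩ := hL
  obtain ⟨v, hv⟩ := exists_ne (0 : V)
  have h1 : Injective (L ^ n).toLinearMap := by
    rw [toLinearMap_pow, Module.End.coe_pow]
    exact hi.iterate n
  rw [hn] at h1
  exact hv (h1 rfl)

variable [FiniteDimensional ℝ V]

/-- The nilpotent endomorphisms of an indecomposable representation, as a two-sided ideal. -/
def nilIdeal (h : IsIndecomposable ρ) : Ideal (End ρ) where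
  carrier := {L | IsNilpotent L}
  add_mem' {a b} ha hb :=
    (mem_nilSpace_iff h _).1 (add_mem ((mem_nilSpace_iff h a).2 ha) ((mem_nilSpace_iff h b).2 hb))
  zero_mem' := IsNilpotent.zero
  smul_mem' c L hL := by
    have := h.1
    refine (isNilpotent_or_bijective h (c * L)).resolve_right fun hb =>
      not_injective_of_isNilpotent hL (Injective.of_comp (f := c) hb.1)

instance nilIdeal_isTwoSided (h : IsIndecomposable ρ) : (nilIdeal h).IsTwoSided where
  mul_mem_of_left {L} c hL := by
    have := h.1
    refine (isNilpotent_or_bijective h (L * c)).resolve_right fun hb =>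
      not_injective_of_isNilpotent hL ?_
    exact LinearMap.injective_iff_surjective.2 (Surjective.of_comp (g := c) hb.2)

/-- The endomorphisms of an indecomposable representation modulo the nilpotent ones form a
division algebra. -/
theorem exists_residueAlgebra {S : Type*} {V : Type u} [Monoid S] [AddCommGroup V] [Module ℝ V]
    [FiniteDimensional ℝ V] {ρ : Representation ℝ S V} (h : IsIndecomposable ρ) :
    ∃ (D : Type u) (_ : DivisionRing D) (_ : Algebra ℝ D) (φ : End ρ →ₐ[ℝ] D),
      Surjective φ ∧ (∀ L, φ L = 0 ↔ IsNilpotent L) ∧ Module.finrank ℝ D = ind ρ := by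
  have := h.1
  have hz : ∀ L : End ρ, Ideal.Quotient.mk (nilIdeal h) L = 0 ↔ IsNilpotent L := fun L =>
    Ideal.Quotient.eq_zero_iff_mem
  have : Nontrivial (End ρ ⧸ nilIdeal h) := by
    refine ⟨⟨Ideal.Quotient.mk _ 1, 0, fun h1 => ?_⟩⟩
    exact not_injective_of_isNilpotent ((hz 1).1 h1) injective_id
  let _ : DivisionRing (End ρ ⧸ nilIdeal h) := DivisionRing.ofIsUnitOrEqZero fun a => by
    obtain ⟨L, rfl⟩ := Ideal.Quotient.mk_surjective a
    rcases isNilpotent_or_bijective h L with hL | hL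
    · exact Or.inr ((hz L).2 hL)
    · exact Or.inl ((isUnit_of_bijective hL).map _)
  refine ⟨End ρ ⧸ nilIdeal h, inferInstance, inferInstance, Ideal.Quotient.mkₐ ℝ (nilIdeal h),
    Ideal.Quotient.mk_surjective, hz, ?_⟩
  have h1 : nilSpace ρ = (nilIdeal h).restrictScalars ℝ := by
    ext L
    exact mem_nilSpace_iff h L
  rw [ind, h1]
  exact (Submodule.Quotient.restrictScalarsEquiv ℝ (nilIdeal h)).finrank_eq.symm

/-- Endomorphisms of an indecomposable representation that factor through a nonisomorphic one are
nilpotent. -/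
theorem isNilpotent_comp {W : Type*} [AddCommGroup W] [Module ℝ W]
    {σ : Representation ℝ S W} (hρ : IsIndecomposable ρ) (hσ : IsIndecomposable σ)
    (hne : IsEmpty (ρ.Equiv σ)) (g : IntertwiningMap σ ρ) (f : IntertwiningMap ρ σ) :
    IsNilpotent (g.comp f : End ρ) := by
  refine (isNilpotent_or_bijective hρ (g.comp f)).resolve_right fun hb => ?_
  have hinj : Injective f := Injective.of_comp (f := g) hb.1
  have hc : IsCompl f.range.toSubmodule g.ker.toSubmodule := by
    constructor
    · rw [Submodule.disjoint_def]
      rintro _ ⟨v, rfl⟩ hv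
      have : v = 0 := hb.1 (hv.trans (map_zero (g.comp f).toLinearMap).symm)
      rw [this, map_zero]
    · rw [codisjoint_iff_le_sup]
      intro w _
      obtain ⟨v, hv⟩ := hb.2 (g w)
      have hv' : g (f v) = g w := hv
      rw [← add_sub_cancel (f v) w]
      refine Submodule.add_mem_sup ⟨v, rfl⟩ ?_
      change g (w - f v) = 0
      rw [map_sub, hv', sub_self]
  rcases hσ.2 _ _ hc with h1 | h1
  · have hs : Surjective f := fun w =>
      (h1 ▸ (Submodule.mem_top : w ∈ (⊤ : Submodule ℝ W)) : w ∈ f.range)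
    exact hne.false (f.ofBijective ⟨hinj, hs⟩)
  · have := hρ.1
    obtain ⟨v, hv⟩ := exists_ne (0 : V)
    have h2 : f v ∈ g.ker := h1 ▸ (Submodule.mem_top : f v ∈ (⊤ : Submodule ℝ W))
    exact hv (hb.1 (h2.trans (map_zero (g.comp f).toLinearMap).symm))

end Residue

/-! ### Direct sums of representations -/

section DirectSum

variable {S : Type*} [Monoid S] {I : Type*} [DecidableEq I] {V : I → Type*}
  [∀ i, AddCommGroup (V i)] [∀ i, Module ℝ (V i)]

/-- The inclusion of a summand of a direct sum of representations. -/
noncomputable def directSumIncl (ρ : ∀ i, Representation ℝ S (V i)) (i : I) :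
    IntertwiningMap (ρ i) (Representation.directSum ρ) where
  toLinearMap := DirectSum.lof ℝ I V i
  isIntertwining' g := by
    ext1 v
    exact (DirectSum.lmap_lof (R := ℝ) (fun i => ρ i g) i v).symm

/-- The projection of a direct sum of representations to a summand. -/
noncomputable def directSumProj (ρ : ∀ i, Representation ℝ S (V i)) (i : I) :
    IntertwiningMap (Representation.directSum ρ) (ρ i) where
  toLinearMap := DirectSum.component ℝ I V i
  isIntertwining' _ := rfl

theorem directSumProj_comp_incl_self (ρ : ∀ i, Representation ℝ S (V i)) (i : I) :
    (directSumProj ρ i).comp (directSumIncl ρ i) = IntertwiningMap.id (ρ i) := by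
  ext v
  exact DirectSum.component.lof_self ℝ i v

theorem directSumProj_comp_incl_of_ne (ρ : ∀ i, Representation ℝ S (V i)) {i j : I} (h : i ≠ j) :
    (directSumProj ρ i).comp (directSumIncl ρ j) = 0 := by
  ext v
  exact (DirectSum.component.of ℝ i j v).trans (dif_neg h.symm)

theorem sum_directSumIncl_comp_proj [Fintype I] (ρ : ∀ i, Representation ℝ S (V i)) :
    ∑ i, (directSumIncl ρ i).comp (directSumProj ρ i) =
      IntertwiningMap.id (Representation.directSum ρ) := by
  refine IntertwiningMap.ext (LinearMap.ext fun v => ?_)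
  rw [IntertwiningMap.toLinearMap_sum, LinearMap.sum_apply]
  exact DirectSum.sum_univ_of v

end DirectSum

end MonoidRep

/-! ### Block matrices of intertwining maps -/

namespace MonoidRep

open Function Representation

section Blocks

variable {S : Type*} [Monoid S]

section Comp

variable {V W U : Type*} [AddCommGroup V] [Module ℝ V] [AddCommGroup W] [Module ℝ W]
  [AddCommGroup U] [Module ℝ U] {ρ : Representation ℝ S V} {σ : Representation ℝ S W}
  {τ : Representation ℝ S U}

theorem sum_comp {I : Type*} (s : Finset I) (f : I → IntertwiningMap σ τ)
    (g : IntertwiningMap ρ σ) : (∑ i ∈ s, f i).comp g = ∑ i ∈ s, (f i).comp g := by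
  simp only [IntertwiningMap.comp_def, map_sum, LinearMap.sum_apply]

theorem comp_sum {I : Type*} (s : Finset I) (f : IntertwiningMap σ τ)
    (g : I → IntertwiningMap ρ σ) : f.comp (∑ i ∈ s, g i) = ∑ i ∈ s, f.comp (g i) := by
  simp only [IntertwiningMap.comp_def, map_sum]

end Comp

/-- A representation isomorphic to a direct sum of powers is described by the inclusions of, and
the projections to, the individual summands. -/
theorem exists_incl_proj {I : Type*} [Fintype I] [DecidableEq I] {X : I → Type*}
    [∀ i, AddCommGroup (X i)] [∀ i, Module ℝ (X i)] (ρX : ∀ i, Representation ℝ S (X i))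
    (s : I → ℕ) {V : Type*} [AddCommGroup V] [Module ℝ V] {ρ : Representation ℝ S V}
    (e : ρ.Equiv (Representation.directSum fun i => power (ρX i) (s i))) :
    ∃ (ι : ∀ i, Fin (s i) → IntertwiningMap (ρX i) ρ)
      (q : ∀ i, Fin (s i) → IntertwiningMap ρ (ρX i)),
      (∀ i b c, (q i b).comp (ι i c) = if b = c then IntertwiningMap.id (ρX i) else 0) ∧
      (∀ i i' b c, i ≠ i' → (q i b).comp (ι i' c) = 0) ∧
      ∑ i, ∑ c, (ι i c).comp (q i c) = IntertwiningMap.id ρ := by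
  let P := fun i => power (ρX i) (s i)
  let ι' : ∀ i (c : Fin (s i)), IntertwiningMap (ρX i) (P i) := fun i c =>
    directSumIncl (fun _ : Fin (s i) => ρX i) c
  let q' : ∀ i (c : Fin (s i)), IntertwiningMap (P i) (ρX i) := fun i c =>
    directSumProj (fun _ : Fin (s i) => ρX i) c
  let f := e.toIntertwiningMap
  let g := e.symm.toIntertwiningMap
  have hfg : f.comp g = IntertwiningMap.id _ := by
    refine IntertwiningMap.ext (LinearMap.ext fun v => ?_)
    exact e.apply_symm_apply v
  have hgf : g.comp f = IntertwiningMap.id _ := by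
    refine IntertwiningMap.ext (LinearMap.ext fun v => ?_)
    exact e.symm_apply_apply v
  have hcomp : ∀ i i' b c, ((q' i b).comp ((directSumProj P i).comp f)).comp
      (g.comp ((directSumIncl P i').comp (ι' i' c))) =
      (q' i b).comp (((directSumProj P i).comp (directSumIncl P i')).comp (ι' i' c)) := by
    intro i i' b c
    change (q' i b).comp ((directSumProj P i).comp
      ((f.comp g).comp ((directSumIncl P i').comp (ι' i' c)))) = _
    rw [hfg]
    rfl
  refine ⟨fun i c => g.comp ((directSumIncl P i).comp (ι' i c)),
    fun i c => (q' i c).comp ((directSumProj P i).comp f), ?_, ?_, ?_⟩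
  · intro i b c
    rw [hcomp, directSumProj_comp_incl_self]
    change (q' i b).comp (ι' i c) = _
    split_ifs with h
    · rw [h]
      exact directSumProj_comp_incl_self _ _
    · exact directSumProj_comp_incl_of_ne _ h
  · intro i i' b c h
    rw [hcomp, directSumProj_comp_incl_of_ne _ h]
    refine IntertwiningMap.ext (LinearMap.ext fun v => ?_)
    exact map_zero (q' i b)
  · have h1 : ∀ i, ∑ c, (g.comp ((directSumIncl P i).comp (ι' i c))).comp
        ((q' i c).comp ((directSumProj P i).comp f)) =
        g.comp (((directSumIncl P i).comp (directSumProj P i)).comp f) := by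
      intro i
      have h2 : ∑ c, (ι' i c).comp (q' i c) = IntertwiningMap.id (P i) :=
        sum_directSumIncl_comp_proj _
      change ∑ c, (g.comp (directSumIncl P i)).comp (((ι' i c).comp (q' i c)).comp
        ((directSumProj P i).comp f)) = _
      rw [← comp_sum, ← sum_comp, h2]
      rfl
    simp only [h1]
    rw [← comp_sum, ← sum_comp, sum_directSumIncl_comp_proj]
    exact hgf

variable {X : Type*} [AddCommGroup X] [Module ℝ X] {ρX : Representation ℝ S X}
  {D : Type*} [DivisionRing D] [Algebra ℝ D]

/-- Maps `ι` from `X` to a representation and `q` back to `X` form a block system with respect to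
an algebra homomorphism `φ : End X → D` if, after applying `φ`, they behave like the inclusions
and projections of a direct sum of copies of `X`. The remaining summands of the
representation are invisible to `φ`. -/
structure IsBlockSystem {V : Type*} [AddCommGroup V] [Module ℝ V] {ρ : Representation ℝ S V}
    (φ : End ρX →ₐ[ℝ] D) {t : ℕ} (ι : Fin t → IntertwiningMap ρX ρ)
    (q : Fin t → IntertwiningMap ρ ρX) : Prop where
  map_proj_comp_incl : ∀ b c, φ ((q b).comp (ι c)) = (1 : Matrix (Fin t) (Fin t) D) b c
  map_comp : ∀ (g : IntertwiningMap ρ ρX) (f : IntertwiningMap ρX ρ),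
    φ (g.comp f) = ∑ c, φ (g.comp (ι c)) * φ ((q c).comp f)

/-- The matrix over `D` of an intertwining map with respect to two block systems. -/
def blockMatrix {V W : Type*} [AddCommGroup V] [Module ℝ V] [AddCommGroup W] [Module ℝ W]
    {ρ : Representation ℝ S V} {σ : Representation ℝ S W} (φ : End ρX →ₐ[ℝ] D) {t t' : ℕ}
    (q : Fin t → IntertwiningMap σ ρX) (ι : Fin t' → IntertwiningMap ρX ρ) :
    IntertwiningMap ρ σ →ₗ[ℝ] Matrix (Fin t) (Fin t') D where
  toFun f := Matrix.of fun b c => φ ((q b).comp (f.comp (ι c)))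
  map_add' f g := by
    ext b c
    simp [IntertwiningMap.comp_add, IntertwiningMap.add_comp]
  map_smul' r f := by
    ext b c
    simp [IntertwiningMap.comp_smul, IntertwiningMap.smul_comp]

section

variable {V V' W : Type*} [AddCommGroup V] [Module ℝ V] [AddCommGroup W] [Module ℝ W]
  [AddCommGroup V'] [Module ℝ V'] {ρ : Representation ℝ S V} {σ : Representation ℝ S W}
  {ρ' : Representation ℝ S V'} {φ : End ρX →ₐ[ℝ] D} {t t' t'' : ℕ}

theorem blockMatrix_comp {ι' : Fin t' → IntertwiningMap ρX ρ'} {q' : Fin t' → IntertwiningMap ρ' ρX}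
    (h : IsBlockSystem φ ι' q') (q : Fin t → IntertwiningMap σ ρX)
    (ι : Fin t'' → IntertwiningMap ρX ρ) (g : IntertwiningMap ρ' σ) (f : IntertwiningMap ρ ρ') :
    blockMatrix φ q ι (g.comp f) = blockMatrix φ q ι' g * blockMatrix φ q' ι f := by
  ext b c
  rw [Matrix.mul_apply]
  exact h.map_comp ((q b).comp g) (f.comp (ι c))

theorem blockMatrix_id {ι : Fin t → IntertwiningMap ρX ρ} {q : Fin t → IntertwiningMap ρ ρX}
    (h : IsBlockSystem φ ι q) : blockMatrix φ q ι (IntertwiningMap.id ρ) = 1 := by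
  ext b c
  exact h.map_proj_comp_incl b c

theorem blockMatrix_pow {ι : Fin t → IntertwiningMap ρX ρ} {q : Fin t → IntertwiningMap ρ ρX}
    (h : IsBlockSystem φ ι q) (f : End ρ) (n : ℕ) :
    blockMatrix φ q ι (f ^ n) = blockMatrix φ q ι f ^ n := by
  induction n with
  | zero => exact blockMatrix_id h
  | succ n ih =>
    rw [pow_succ, pow_succ, ← ih]
    exact blockMatrix_comp h q ι (f ^ n) f

end

/-- In a direct sum of powers of pairwise nonisomorphic indecomposable representations the
summands isomorphic to `X i` form a block system for the residue algebra of `X i`. -/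
theorem isBlockSystem_of_incl_proj {I : Type*} [Fintype I] {Y : I → Type*}
    [∀ i, AddCommGroup (Y i)] [∀ i, Module ℝ (Y i)] [∀ i, FiniteDimensional ℝ (Y i)]
    {ρY : ∀ i, Representation ℝ S (Y i)} (hind : ∀ i, IsIndecomposable (ρY i))
    (hne : ∀ i i', i ≠ i' → IsEmpty ((ρY i).Equiv (ρY i')))
    {s : I → ℕ} {V : Type*} [AddCommGroup V] [Module ℝ V] {ρ : Representation ℝ S V}
    {ι : ∀ i, Fin (s i) → IntertwiningMap (ρY i) ρ}
    {q : ∀ i, Fin (s i) → IntertwiningMap ρ (ρY i)}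
    (h1 : ∀ i b c, (q i b).comp (ι i c) = if b = c then IntertwiningMap.id (ρY i) else 0)
    (h2 : ∑ i, ∑ c, (ι i c).comp (q i c) = IntertwiningMap.id ρ)
    (i : I) (φ : End (ρY i) →ₐ[ℝ] D) (hφ : ∀ L, IsNilpotent L → φ L = 0) :
    IsBlockSystem φ (ι i) (q i) where
  map_proj_comp_incl b c := by
    rw [h1, Matrix.one_apply]
    split_ifs
    · exact map_one φ
    · exact map_zero φ
  map_comp g f := by
    have h3 : g.comp f = ∑ i', ∑ c, (g.comp (ι i' c)).comp ((q i' c).comp f) := by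
      have : g.comp f = g.comp ((∑ i, ∑ c, (ι i c).comp (q i c)).comp f) := by rw [h2]; rfl
      rw [this]
      simp only [sum_comp, comp_sum]
      rfl
    rw [h3, map_sum, Finset.sum_eq_single i]
    · rw [map_sum]
      exact Finset.sum_congr rfl fun c _ => map_mul φ (g.comp (ι i c)) ((q i c).comp f)
    · intro i' _ hi'
      rw [map_sum]
      exact Finset.sum_eq_zero fun c _ =>
        hφ _ (isNilpotent_comp (hind i) (hind i') (hne i i' hi'.symm) _ _)
    · exact fun h => (h (Finset.mem_univ i)).elim

end Blocks

/-! ### The Fitting decomposition -/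

section Fitting

variable {S V W : Type*} [Monoid S] [AddCommGroup V] [Module ℝ V] [FiniteDimensional ℝ V]
  [AddCommGroup W] [Module ℝ W] {ρ : Representation ℝ S V} {σ : Representation ℝ S W}

/-- An endomorphism `L` whose generalized kernel is isomorphic to `W` restricts to a nilpotent
endomorphism `N` of the direct summand `W` of `V` and is invertible on a complement. -/
theorem exists_fitting {L : End ρ} (hL : L ∈ isoSet ρ σ) :
    ∃ (u : IntertwiningMap σ ρ) (v : IntertwiningMap ρ σ) (N : End σ) (G : End ρ),
      v.comp u = IntertwiningMap.id σ ∧ L.comp u = u.comp N ∧ v.comp L = N.comp v ∧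
      IsNilpotent N ∧ L.comp G = IntertwiningMap.id ρ - u.comp v := by
  obtain ⟨e⟩ := hL
  -- the exponent `n + 1` instead of `n` makes `L` a factor of `T` even if `V` is zero
  set n := Module.finrank ℝ V
  set T : End ρ := L ^ (n + 1) with hT
  have hTL : T.toLinearMap = L.toLinearMap ^ (n + 1) := toLinearMap_pow L _
  have hK : (gker ρ L).toSubmodule = LinearMap.ker T.toLinearMap := by
    change LinearMap.ker (L ^ n).toLinearMap = _
    rw [hTL, toLinearMap_pow]
    exact (Module.End.ker_pow_eq_ker_pow_finrank_of_le (Nat.le_succ n)).symm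
  have hdisj : Disjoint (LinearMap.ker T.toLinearMap) (LinearMap.range T.toLinearMap) := by
    rw [Submodule.disjoint_def]
    rintro _ h1 ⟨w, rfl⟩
    rw [LinearMap.mem_ker, hTL, ← Module.End.mul_apply, ← pow_add] at h1
    have h2 : w ∈ LinearMap.ker (L.toLinearMap ^ (n + 1)) := by
      rw [Module.End.ker_pow_eq_ker_pow_finrank_of_le (Nat.le_succ n),
        ← Module.End.ker_pow_eq_ker_pow_finrank_of_le (m := n + 1 + (n + 1)) (by omega)]
      exact h1
    rw [hTL]
    exact h2
  have hc : IsCompl (gker ρ L).toSubmodule T.range.toSubmodule := by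
    rw [hK]
    refine (Submodule.isCompl_iff_disjoint _ _ ?_).2 hdisj
    rw [add_comm]
    exact T.toLinearMap.finrank_range_add_finrank_ker.ge
  set K := gker ρ L
  let P : V →ₗ[ℝ] K.toSubmodule := K.toSubmodule.projectionOnto _ hc
  have hPK : ∀ x (hx : x ∈ K.toSubmodule), P x = ⟨x, hx⟩ := fun x hx =>
    Submodule.projectionOnto_apply_left hc ⟨x, hx⟩
  have hPR : ∀ x ∈ T.range.toSubmodule, P x = 0 := fun x hx =>
    Submodule.projectionOnto_apply_right hc ⟨x, hx⟩
  have hcomm : ∀ A : V →ₗ[ℝ] V, (∀ x ∈ K.toSubmodule, A x ∈ K.toSubmodule) →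
      (∀ x ∈ T.range.toSubmodule, A x ∈ T.range.toSubmodule) → ∀ x, (P (A x) : V) = A (P x) := by
    intro A hAK hAR x
    obtain ⟨a, ha, b, hb, rfl⟩ := Submodule.mem_sup.1 (hc.sup_eq_top.ge (Submodule.mem_top (x := x)))
    rw [map_add A, map_add P, map_add P, hPK a ha, hPK _ (hAK a ha), hPR b hb, hPR _ (hAR b hb)]
    simp
  have hLT : ∀ x, L (T x) = T (L x) := fun x =>
    DFunLike.congr_fun (((Commute.refl L).pow_right (n + 1)).eq : L * T = T * L) x
  have hLK : ∀ x ∈ K.toSubmodule, L x ∈ K.toSubmodule := by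
    intro x hx
    rw [hK] at hx ⊢
    change T (L x) = 0
    rw [← hLT]
    exact (congrArg L hx).trans (map_zero L)
  have hLR : ∀ x ∈ T.range.toSubmodule, L x ∈ T.range.toSubmodule := by
    rintro _ ⟨x, rfl⟩
    exact ⟨L x, (hLT x).symm⟩
  let p : IntertwiningMap ρ K.toRepresentation :=
    { toLinearMap := P
      isIntertwining' := fun g => LinearMap.ext fun x => Subtype.ext <|
        hcomm (ρ g) (K.apply_mem_toSubmodule g) (T.range.apply_mem_toSubmodule g) x }
  let incl : IntertwiningMap K.toRepresentation ρ :=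
    { toLinearMap := K.toSubmodule.subtype
      isIntertwining' := fun _ => rfl }
  let u : IntertwiningMap σ ρ := incl.comp e.symm.toIntertwiningMap
  let v : IntertwiningMap ρ σ := e.toIntertwiningMap.comp p
  have hpi : ∀ x : K.toSubmodule, p (incl x) = x := fun x => hPK x x.2
  have hvu : v.comp u = IntertwiningMap.id σ := by
    refine IntertwiningMap.ext (LinearMap.ext fun w => ?_)
    change e (p (incl (e.symm w))) = w
    rw [hpi, e.apply_symm_apply]
  have huv : ∀ x, u (v x) = (P x : V) := by
    intro x
    change incl (e.symm (e (p x))) = _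
    rw [e.symm_apply_apply]
    rfl
  have hεL : ∀ x, u (v (L x)) = L (u (v x)) := by
    intro x
    rw [huv, huv]
    exact hcomm L.toLinearMap hLK hLR x
  have hvu' : ∀ w, v (u w) = w := fun w => DFunLike.congr_fun hvu w
  let N : End σ := v.comp (L.comp u)
  have hLu : L.comp u = u.comp N := by
    refine IntertwiningMap.ext (LinearMap.ext fun w => ?_)
    change L (u w) = u (v (L (u w)))
    rw [hεL, hvu']
  have hvL : v.comp L = N.comp v := by
    refine IntertwiningMap.ext (LinearMap.ext fun x => ?_)
    change v (L x) = v (L (u (v x)))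
    rw [← hεL, hvu']
  have hTK : ∀ x, T (P x : V) = 0 := fun x => hK.le (P x).2
  have hPT : ∀ x, P (T x) = 0 := fun x => hPR (T x) ⟨x, rfl⟩
  -- `T` is invertible on its range and `u v` is the identity on the generalized kernel
  have hbij : Bijective (T + u.comp v : End ρ).toLinearMap := by
    have hinj : Injective (T + u.comp v : End ρ).toLinearMap := by
      rw [← LinearMap.ker_eq_bot, LinearMap.ker_eq_bot']
      intro x hx
      have h1 : T x + (P x : V) = 0 := by
        rw [← huv]
        exact hx
      have h2 : P x = 0 := by
        have h3 := congrArg P h1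
        rw [map_add, map_zero, hPT, zero_add, hPK _ (P x).2] at h3
        exact h3
      rw [h2, Submodule.coe_zero, add_zero] at h1
      have h3 : x ∈ K.toSubmodule := by
        rw [hK]
        exact h1
      rw [hPK x h3] at h2
      exact congrArg Subtype.val h2
    exact ⟨hinj, LinearMap.injective_iff_surjective.1 hinj⟩
  obtain ⟨Q, hQ⟩ := isUnit_of_bijective hbij
  refine ⟨u, v, N, L ^ n * ↑Q⁻¹, hvu, hLu, hvL, ⟨n + 1, ?_⟩, ?_⟩
  · have hpow : ∀ (m : ℕ) (w : W), u ((N ^ m) w) = (L ^ m) (u w) := by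
      intro m
      induction m with
      | zero => exact fun _ => rfl
      | succ m ih =>
        intro w
        rw [pow_succ, pow_succ]
        change u ((N ^ m) (N w)) = (L ^ m) (L (u w))
        rw [ih]
        exact congrArg (L ^ m) (DFunLike.congr_fun hLu w).symm
    refine IntertwiningMap.ext (LinearMap.ext fun w => ?_)
    change (N ^ (n + 1)) w = 0
    rw [← hvu' ((N ^ (n + 1)) w), hpow, ← hvu' w, huv]
    exact (congrArg v (hTK _)).trans (map_zero v)
  · have h1 : (u.comp v : End ρ) * (T + u.comp v) = u.comp v := by
      refine IntertwiningMap.ext (LinearMap.ext fun x => ?_)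
      change u (v (T x + u (v x))) = u (v x)
      rw [huv, huv, map_add, hPT, zero_add, hPK _ (P x).2]
    have h2 : (u.comp v : End ρ) * ↑Q⁻¹ = u.comp v := by
      rw [← hQ] at h1
      rw [← Units.eq_mul_inv_iff_mul_eq] at h1
      exact h1.symm
    have h3 : T * ↑Q⁻¹ + (u.comp v : End ρ) * ↑Q⁻¹ = 1 := by
      rw [← add_mul, ← hQ, Units.mul_inv]
    change L * (L ^ n * ↑Q⁻¹) = (1 : End ρ) - u.comp v
    rw [← mul_assoc, ← pow_succ', ← hT, eq_sub_iff_add_eq, ← h2, ← h3]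

end Fitting

end MonoidRep

/-! ### Matrices with a nilpotent Fitting block -/

namespace MonoidRep

open Function Representation Matrix

section FittingBlock

variable {D : Type*} [DivisionRing D] {j s : ℕ}

/-- A `j × j` matrix has a Fitting block of size `s` if it acts as a nilpotent `s × s` matrix on a
direct summand and is invertible on a complement of it. -/
def HasFittingBlock (s : ℕ) (A : Matrix (Fin j) (Fin j) D) : Prop :=
  ∃ (u : Matrix (Fin j) (Fin s) D) (v : Matrix (Fin s) (Fin j) D) (N : Matrix (Fin s) (Fin s) D)
    (G : Matrix (Fin j) (Fin j) D),
    v * u = 1 ∧ A * u = u * N ∧ v * A = N * v ∧ IsNilpotent N ∧ A * G = 1 - u * v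

theorem HasFittingBlock.map {D' : Type*} [DivisionRing D'] (ψ : D →+* D')
    {A : Matrix (Fin j) (Fin j) D} (h : HasFittingBlock s A) : HasFittingBlock s (A.map ψ) := by
  obtain ⟨u, v, N, G, h1, h2, h3, h4, h5⟩ := h
  refine ⟨u.map ψ, v.map ψ, N.map ψ, G.map ψ, ?_, ?_, ?_, h4.map ψ.mapMatrix, ?_⟩
  · rw [← Matrix.map_mul, h1]
    exact map_one ψ.mapMatrix
  · rw [← Matrix.map_mul, h2, Matrix.map_mul]
  · rw [← Matrix.map_mul, h3, Matrix.map_mul]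
  · rw [← Matrix.map_mul, h5, ← Matrix.map_mul]
    exact (map_sub ψ.mapMatrix 1 (u * v)).trans (by rw [map_one]; rfl)

/-- The left kernel of the matrix meets the complement trivially, so it embeds into the block. -/
theorem HasFittingBlock.finrank_ker_le {A : Matrix (Fin j) (Fin j) D} (h : HasFittingBlock s A) :
    Module.finrank D (LinearMap.ker A.toLinearMapRight') ≤ s := by
  obtain ⟨u, v, N, G, h1, h2, h3, h4, h5⟩ := h
  have hinj : Injective (u.toLinearMapRight'.domRestrict (LinearMap.ker A.toLinearMapRight')) := by
    rw [← LinearMap.ker_eq_bot, LinearMap.ker_eq_bot']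
    rintro ⟨y, hy⟩ hyu
    have hyA : y ᵥ* A = 0 := hy
    have hyu' : y ᵥ* u = 0 := hyu
    have h6 := congrArg (y ᵥ* ·) h5
    simp only [← vecMul_vecMul, hyA, zero_vecMul, vecMul_sub, vecMul_one, hyu', sub_zero] at h6
    exact Subtype.ext h6.symm
  simpa using LinearMap.finrank_le_finrank_of_injective hinj

/-- A nilpotent block of positive size has a kernel vector. -/
theorem HasFittingBlock.finrank_ker_pos {A : Matrix (Fin j) (Fin j) D} (h : HasFittingBlock s A)
    (hs : 1 ≤ s) : 1 ≤ Module.finrank D (LinearMap.ker A.toLinearMapRight') := by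
  obtain ⟨u, v, N, G, h1, h2, h3, ⟨n, hn⟩, h5⟩ := h
  obtain ⟨y, hy0, hyN⟩ : ∃ y : Fin s → D, y ≠ 0 ∧ y ᵥ* N = 0 := by
    by_contra! hne
    have hinj : ∀ (n : ℕ) (y : Fin s → D), y ᵥ* N ^ n = 0 → y = 0 := by
      intro n
      induction n with
      | zero => exact fun y hy => by simpa using hy
      | succ n ih =>
        intro y hy
        rw [pow_succ', ← vecMul_vecMul] at hy
        by_contra hy0
        exact hne y hy0 (ih _ hy)
    have h6 := congrFun (hinj n 1 (by rw [hn, vecMul_zero])) ⟨0, hs⟩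
    exact one_ne_zero h6
  have hmem : y ᵥ* v ∈ LinearMap.ker A.toLinearMapRight' := by
    change (y ᵥ* v) ᵥ* A = 0
    rw [vecMul_vecMul, h3, ← vecMul_vecMul, hyN, zero_vecMul]
  have hne : y ᵥ* v ≠ 0 := by
    intro h6
    apply hy0
    rw [← vecMul_one y, ← h1, ← vecMul_vecMul, h6, zero_vecMul]
  have : Nontrivial (LinearMap.ker A.toLinearMapRight') :=
    ⟨⟨⟨_, hmem⟩, 0, fun h6 => hne (congrArg Subtype.val h6)⟩⟩
  exact Module.finrank_pos

variable [Algebra ℝ D] [FiniteDimensional ℝ D]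

theorem isSubmanifold_matrix_finrank_ker_eq (j p : ℕ) :
    IsSubmanifold (p ^ 2 * Module.finrank ℝ D) {A : Matrix (Fin j) (Fin j) D |
      Module.finrank D (LinearMap.ker A.toLinearMapRight') = p} := by
  let τ : Matrix (Fin j) (Fin j) D →ₗ[ℝ] Module.End D (Fin j → D) :=
    { toFun := fun A => A.toLinearMapRight'
      map_add' := fun A B => map_add _ A B
      map_smul' := fun r A => LinearMap.ext fun y => Matrix.vecMul_smul y r A }
  have hτ : Surjective τ := Matrix.toLinearMapRight'.surjective
  have : FiniteDimensional ℝ (Module.End D (Fin j → D)) := Module.Finite.of_surjective τ hτ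
  exact (isSubmanifold_finrank_ker_eq (D := D) (U := Fin j → D) p).preimage τ hτ

/-- Matrices of corank one over a copy of `ℝ` with a Fitting block of size `s` lie in a submanifold
of codimension `s`. -/
theorem exists_isSubmanifold_corank_one (hD : Module.finrank ℝ D = 1) (j s : ℕ) :
    ∃ M : Set (Matrix (Fin j) (Fin j) D), IsSubmanifold s M ∧ ∀ A, HasFittingBlock s A →
      Module.finrank D (LinearMap.ker A.toLinearMapRight') = 1 → A ∈ M := by
  let ψ : D ≃ₐ[ℝ] ℝ := (AlgEquiv.ofBijective (Algebra.ofId ℝ D)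
    (Algebra.finrank_eq_one_iff_bijective_algebraMap.1 hD)).symm
  let Ψ : Matrix (Fin j) (Fin j) D →ₗ[ℝ] Matrix (Fin j) (Fin j) ℝ := ψ.toLinearMap.mapMatrix
  have hΨ : Surjective Ψ := fun B => ⟨B.map ψ.symm, by ext a b; exact ψ.apply_symm_apply _⟩
  refine ⟨_, (isSubmanifold_charpoly s).preimage Ψ hΨ, fun A hA h1 => ⟨?_, ?_⟩⟩
  · obtain ⟨⟨y, hy⟩, hy0, hspan⟩ := finrank_eq_one_iff'.1 h1
    have hmap : ∀ z : Fin j → D, (ψ ∘ z) ᵥ* Ψ A = ψ ∘ (z ᵥ* A) := fun z =>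
      (funext fun b => RingHom.map_vecMul (ψ : D →+* ℝ) A z b).symm
    have hy' : y ᵥ* A = 0 := hy
    refine adjugate_neg_ne_zero (y₀ := ψ ∘ y) (fun h => hy0 ?_) ?_ fun z hz => ?_
    · exact Subtype.ext (funext fun b => ψ.injective ((congrFun h b).trans (map_zero ψ).symm))
    · rw [hmap, hy']
      exact funext fun b => map_zero ψ
    · obtain ⟨z, rfl⟩ : ∃ z', ψ ∘ z' = z := ⟨ψ.symm ∘ z, funext fun b => ψ.apply_symm_apply _⟩
      rw [hmap] at hz
      have hz' : z ᵥ* A = 0 :=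
        funext fun b => ψ.injective ((congrFun hz b).trans (map_zero ψ).symm)
      obtain ⟨c, hc⟩ := hspan ⟨z, hz'⟩
      refine ⟨ψ c, funext fun b => ?_⟩
      have hc' : c • y = z := congrArg Subtype.val hc
      rw [← hc']
      exact (map_mul ψ c (y b)).symm
  · obtain ⟨u, v, N, G, h1, h2, h3, h4, h5⟩ := hA.map (ψ : D →+* ℝ)
    exact charpoly_coeff_eq_zero h1 h2 h4

/-- The matrices of corank `p` with a Fitting block of size `s` lie in a submanifold of one of
the admissible codimensions. -/
theorem exists_isSubmanifold_corank {p : ℕ} (hp : 1 ≤ p) (hps : p ≤ s) (j : ℕ) :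
    ∃ d ∈ codims (Module.finrank ℝ D) s, ∃ M : Set (Matrix (Fin j) (Fin j) D),
      IsSubmanifold d M ∧ ∀ A, HasFittingBlock s A →
        Module.finrank D (LinearMap.ker A.toLinearMapRight') = p → A ∈ M := by
  by_cases h : Module.finrank ℝ D = 1 ∧ p = 1
  · obtain ⟨h1, rfl⟩ := h
    exact ⟨s, Or.inl ⟨h1, Or.inl rfl⟩, exists_isSubmanifold_corank_one h1 j s⟩
  · refine ⟨p ^ 2 * Module.finrank ℝ D, ?_, _, isSubmanifold_matrix_finrank_ker_eq j p,
      fun A _ hA => hA⟩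
    rcases finrank_divisionRing (D := D) with h1 | h1
    · exact Or.inl ⟨h1, Or.inr ⟨p, by omega, hps, by rw [h1, mul_one]⟩⟩
    · exact Or.inr ⟨h1, p, hp, hps, rfl⟩

end FittingBlock

end MonoidRep

theorem theorem2p6 {S V : Type*} [Monoid S] [AddCommGroup V] [Module ℝ V] [FiniteDimensional ℝ V]
    (ρ : Representation ℝ S V)
    (m : ℕ) (X : Fin m → Type*) [∀ i, AddCommGroup (X i)] [∀ i, Module ℝ (X i)]
    [∀ i, FiniteDimensional ℝ (X i)]
    (ρX : ∀ i, Representation ℝ S (X i))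
    (hindec : ∀ i, MonoidRep.IsIndecomposable (ρX i))
    (hnoniso : ∀ i i', i ≠ i' → IsEmpty ((ρX i).Equiv (ρX i')))
    (j : Fin m → ℕ)
    (hV : Nonempty (ρ.Equiv
      (Representation.directSum fun i : Fin m => MonoidRep.power (ρX i) (j i))))
    (k : ℕ) (i : Fin k → Fin m) (hi : StrictMono i)
    (s : Fin k → ℕ) (hs : ∀ r, 1 ≤ s r ∧ s r ≤ j (i r)) :
    ∃ (N : ℕ) (M : Fin N → Set (MonoidRep.End ρ)) (d : Fin N → Fin k → ℕ),
      (∀ a r, d a r ∈ MonoidRep.codims (MonoidRep.ind (ρX (i r))) (s r)) ∧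
      (∀ a, MonoidRep.IsSubmanifold (∑ r, d a r) (M a)) ∧
      MonoidRep.isoSet ρ
        (Representation.directSum fun r : Fin k => MonoidRep.power (ρX (i r)) (s r)) ⊆
        ⋃ a, M a := by
  open MonoidRep Representation in
  choose D iD iA φ hφs hφ0 hdim using fun i => exists_residueAlgebra (hindec i)
  have hfin : ∀ i, FiniteDimensional ℝ (D i) := fun i =>
    Module.Finite.of_surjective (φ i).toLinearMap (hφs i)
  obtain ⟨e⟩ := hV
  obtain ⟨ι, q, hqι, hqι0, hid⟩ := exists_incl_proj ρX j e
  have hsys : ∀ i, IsBlockSystem (φ i) (ι i) (q i) := fun i =>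
    isBlockSystem_of_incl_proj hindec hnoniso hqι hid i (φ i) fun L => (hφ0 i L).2
  obtain ⟨ι', q', hqι', -, hid'⟩ := exists_incl_proj (fun r => ρX (i r)) s
    (Representation.Equiv.refl (directSum fun r : Fin k => power (ρX (i r)) (s r)))
  have hsys' : ∀ r, IsBlockSystem (φ (i r)) (ι' r) (q' r) := fun r =>
    isBlockSystem_of_incl_proj (fun r => hindec (i r))
      (fun r r' h => hnoniso _ _ (hi.injective.ne h)) hqι' hid' r (φ (i r))
      fun L => (hφ0 (i r) L).2
  -- the matrices over the residue algebras of the representations in the generalized kernel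
  let π := fun r : Fin k => blockMatrix (ρ := ρ) (σ := ρ) (φ (i r)) (q (i r)) (ι (i r))
  have hπ : ∀ y : ∀ r, Matrix (Fin (j (i r))) (Fin (j (i r))) (D (i r)), ∃ x, ∀ r, π r x = y r := by
    intro y
    choose a ha using fun r b c => hφs (i r) (y r b c)
    -- lift the matrix entries to endomorphisms and place them in the corresponding blocks
    refine ⟨∑ r, ∑ b, ∑ c, (ι (i r) b).comp ((a r b c).comp (q (i r) c)), fun r => ?_⟩
    ext b c
    have hterm : ∀ r' b' c', π r ((ι (i r') b').comp ((a r' b' c').comp (q (i r') c'))) b c =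
        φ (i r) (((q (i r) b).comp (ι (i r') b')).comp
          ((a r' b' c').comp ((q (i r') c').comp (ι (i r) c)))) := fun _ _ _ => rfl
    simp only [map_sum, Matrix.sum_apply, hterm]
    rw [Finset.sum_eq_single r, Finset.sum_eq_single b, Finset.sum_eq_single c]
    · rw [hqι, hqι, if_pos rfl, if_pos rfl]
      exact ha r b c
    · intro c' _ hc'
      rw [hqι _ c' c, if_neg hc']
      exact (congrArg (φ (i r)) (IntertwiningMap.ext (LinearMap.ext fun x =>
        (congrArg ((q (i r) b).comp (ι (i r) b)) (map_zero (a r b c'))).trans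
          (map_zero ((q (i r) b).comp (ι (i r) b)))))).trans (map_zero (φ (i r)))
    · exact fun h => (h (Finset.mem_univ c)).elim
    · intro b' _ hb'
      refine Finset.sum_eq_zero fun c' _ => ?_
      rw [hqι _ b b', if_neg hb'.symm]
      exact map_zero (φ (i r))
    · exact fun h => (h (Finset.mem_univ b)).elim
    · intro r' _ hr'
      refine Finset.sum_eq_zero fun b' _ => Finset.sum_eq_zero fun c' _ => ?_
      rw [hqι0 _ _ b b' (hi.injective.ne hr'.symm)]
      exact map_zero (φ (i r))
    · exact fun h => (h (Finset.mem_univ r)).elim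
  have key : ∀ L ∈ isoSet ρ (directSum fun r : Fin k => power (ρX (i r)) (s r)),
      ∀ r, HasFittingBlock (s r) (π r L) := by
    intro L hL r
    obtain ⟨u, v, N, G, h1, h2, h3, ⟨n, hn⟩, h5⟩ := exists_fitting hL
    refine ⟨blockMatrix (φ (i r)) (q (i r)) (ι' r) u, blockMatrix (φ (i r)) (q' r) (ι (i r)) v,
      blockMatrix (φ (i r)) (q' r) (ι' r) N, π r G, ?_, ?_, ?_, ⟨n, ?_⟩, ?_⟩
    · rw [← blockMatrix_comp (hsys _), h1, blockMatrix_id (hsys' r)]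
    · rw [← blockMatrix_comp (hsys _), ← blockMatrix_comp (hsys' r), h2]
    · rw [← blockMatrix_comp (hsys _), ← blockMatrix_comp (hsys' r), h3]
    · rw [← blockMatrix_pow (hsys' r), hn, map_zero]
    · rw [← blockMatrix_comp (hsys _), ← blockMatrix_comp (hsys' r), h5, map_sub,
        blockMatrix_id (hsys _)]
  -- the strata are indexed by tuples of coranks, shifted by one so that they start at zero
  choose d hd M hM hMA using fun (r : Fin k) (p : Fin (s r)) =>
    exists_isSubmanifold_corank (D := D (i r)) (s := s r) (p := p + 1) (by omega) (by omega) (j (i r))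
  let f := (Fintype.equivFin (∀ r, Fin (s r))).symm
  refine ⟨Fintype.card (∀ r, Fin (s r)), fun a => {L | ∀ r, π r L ∈ M r (f a r)},
    fun a r => d r (f a r), fun a r => hdim (i r) ▸ hd r _,
    fun a => IsSubmanifold.iInter_preimage π hπ fun r => hM r _, fun L hL => ?_⟩
  have hpos := fun r => (key L hL r).finrank_ker_pos (hs r).1
  have hle := fun r => (key L hL r).finrank_ker_le
  refine Set.mem_iUnion.2 ⟨f.symm fun r => ⟨Module.finrank (D (i r))
    (LinearMap.ker (π r L).toLinearMapRight') - 1, ?_⟩, fun r => ?_⟩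
  · have := hpos r
    have := hle r
    omega
  · rw [Equiv.apply_symm_apply]
    exact hMA r _ _ (key L hL r) (Nat.sub_add_cancel (hpos r)).symm
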